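/- **Conventions.** Let $\mathfrak S_n$ be the symmetric group on $[n]=\{1,\dots,n\}$, let $s_i=(i\;\,i{+}1)$, and let $\ell(u)$ be the number of inversions of $u$. For $1\le i\le n-1$ let $\tau_i(u)=us_i$ if $\ell(us_i)>\ell(u)$ and $\tau_i(u)=u$ otherwise (so $\tau_i$ puts the entries in positions $i,i+1$ in decreasing order); for a word $\mathbf w=(i_1,\dots,i_r)$ let $\tau_{\mathbf w}=\tau_{i_r}\circ\cdots\circ\tau_{i_1}$. A box is a unit square whose lower-left vertex is a point $(x,y)\in\mathbb Z^2$ with $x>y$; its content is $x-y$. A shape is a finite set of boxes, ordered by $(x,y)\le(x',y')$ iff $x\le x'$ and $y\le y'$; a word $\mathbf w(\mathscr S)$ of a shape $\mathscr S$ lists the contents of its boxes along a linear extension of this order. A permuton is a probability measure on $[0,1]^2$ with uniform marginals. For $u\in\mathfrak S_n$, $\pi_u$ is the permuton with density $n$ on the squares $\left[\frac{i-1}n,\frac in\right]\times\left[\frac{u(i)-1}n,\frac{u(i)}n\right]$, $1\le i\le n$, and density $0$ elsewhere. For $\alpha\ge0$ and $\beta\in[0,1]$ put $a=\frac{\alpha}{1-\beta}$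 and $b=\frac{\alpha}{\beta}$, where a quotient with denominator $0$ is read as $\infty$ (also if $\alpha=0$), and $$g(x)=\frac{\alpha}{(1-\beta)(1-x)+\alpha},\qquad h(x)=\frac{\alpha}{\beta x+\alpha}$$ (values at points where a denominator vanishes are irrelevant below). Let $$\mathscr U_{\searrow}=\{(x,y)\in[0,1]^2: x\ge a,\ y\le\min\{1-\beta,1-a\},\ y\le 1-g(x)\},$$ $$\mathscr U_{\nwarrow}=\{(x,y)\in[0,1]^2: x\le 1-b,\ y\ge\max\{1-\beta,b\},\ y\ge h(x)\},$$ $$\mathscr C_{\searrow}=\{(x,1-g(x)):\max\{a,1-b\}\le x\le1\},\qquad \mathscr C_{\nwarrow}=\{(x,h(x)):0\le x\le\min\{a,1-b\}\},$$ $$\mathscr L=\{(x,1-x)\in[0,1]^2:1-b\le x\le a\},$$ and let $\nu^{\alpha,\beta}$ be the measure on $[0,1]^2$ given by $$\nu^{\alpha,\beta}(A)=\iint_{A\cap(\mathscr U_{\searrow}\cup\mathscr U_{\nwarrow})}\mathrm dx\,\mathrm dy+\int_{A\cap\mathscr C_{\searrow}}g(x)\,\mathrm dx+\int_{A\cap\mathscr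 C_{\nwarrow}}h(x)\,\mathrm dx+\int_{A\cap\mathscr L}\mathrm dx ,$$ where an integral over part of a curve with respect to $\mathrm dx$ is taken over the set of abscissas of its points. **Theorem 1.5.** Fix $\beta\in[0,1]$. For each $n$ let $\mathscr S^{(n)}$ be a rectangle shape of height $\lfloor(1-\beta)n\rfloor$ and width $\lceil\beta n\rceil$ all of whose boxes have contents in $\{1,\dots,n-1\}$, and let $\mathbf w(\mathscr S^{(n)})$ be any word of it. Let $v_1,v_2,\dots$ be random permutations on a common probability space, $v_n$ being uniformly distributed on $\mathfrak S_n$ (with an arbitrary joint distribution; for example independent), and let $u_n=\tau_{\mathbf w(\mathscr S^{(n)})}(v_n)$. Then $\nu^{\beta(1-\beta),\beta}$ is a permuton, and with probability $1$ the sequence $(\pi_{u_n})_{n\ge1}$ converges weakly to $\nu^{\beta(1-\beta),\beta}$. -/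

import Mathlib

open MeasureTheory Filter Topology
open scoped ENNReal

namespace BubblePermuton

noncomputable section

/-! ### Permutations, the operators `τ`, and shapes

The permutations of `{1, …, n}` are `Equiv.Perm (Fin n)`, where `j : Fin n` stands for `j + 1`. -/

/-- The number of inversions of `v`: pairs `a < b` of values such that `v⁻¹ a > v⁻¹ b`. -/
def invCount {n : ℕ} (v : Equiv.Perm (Fin n)) : ℕ :=
  (Finset.univ.filter (fun p : Fin n × Fin n => p.1 < p.2 ∧ v⁻¹ p.2 < v⁻¹ p.1)).card

/-- The simple transposition `s_i = (i i+1)`, for `1 ≤ i ≤ n - 1`. Letters outside this range are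
not used; they give the identity. -/
def simpleTransposition (n : ℕ) (i : ℤ) : Equiv.Perm (Fin n) :=
  if h : 1 ≤ i ∧ i ≤ (n : ℤ) - 1 then
    Equiv.swap ⟨(i - 1).toNat, by omega⟩ ⟨i.toNat, by omega⟩
  else 1

/-- The operator `τ_i`: `u s_i` if this has more inversions than `u`, and `u` otherwise. -/
def tau {n : ℕ} (i : ℤ) (u : Equiv.Perm (Fin n)) : Equiv.Perm (Fin n) :=
  if invCount u < invCount (u * simpleTransposition n i) then u * simpleTransposition n i else u

/-- For a word `w = (i₁, …, i_r)`, the operator `τ_w = τ_{i_r} ∘ ⋯ ∘ τ_{i₁}` (the letter `i₁` acts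
first). -/
def tauWord {n : ℕ} (w : List ℤ) (u : Equiv.Perm (Fin n)) : Equiv.Perm (Fin n) :=
  w.foldl (fun v i => tau i v) u

/-- The box with lower-left vertex `(x, y)` is represented by `(x, y)`; its content is `x - y`. -/
def content (b : ℤ × ℤ) : ℤ := b.1 - b.2

/-- `S` is an axis-parallel rectangle of boxes of height `h` and width `w`. -/
def IsRectangle (S : Finset (ℤ × ℤ)) (h w : ℕ) : Prop :=
  ∃ a b : ℤ, S = Finset.Ico a (a + w) ×ˢ Finset.Ico b (b + h)

/-- `l` is a linear extension of `S`, ordered by `(x, y) ≤ (x', y')` iff `x ≤ x'` and `y ≤ y'`: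
it lists every box of `S` exactly once, and no box precedes a smaller one. -/
def IsLinearExtension (S : Finset (ℤ × ℤ)) (l : List (ℤ × ℤ)) : Prop :=
  l.Nodup ∧ (∀ b, b ∈ l ↔ b ∈ S) ∧ l.Pairwise (fun b b' => ¬ b' ≤ b)

/-- `w` is a word of the shape `S`: the contents of the boxes, read along a linear extension. -/
def IsWordOfShape (S : Finset (ℤ × ℤ)) (w : List ℤ) : Prop :=
  ∃ l : List (ℤ × ℤ), IsLinearExtension S l ∧ w = l.map content

/-! ### Permutons -/

/-- A permuton: a probability measure on the unit square (seen as a measure on the plane that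
vanishes off the square) with uniform marginals. -/
def IsPermuton (μ : Measure (ℝ × ℝ)) : Prop :=
  IsProbabilityMeasure μ ∧ μ (Set.Icc (0 : ℝ) 1 ×ˢ Set.Icc (0 : ℝ) 1)ᶜ = 0 ∧
    ∀ a b : ℝ, 0 ≤ a → a ≤ b → b ≤ 1 →
      μ (Set.Icc 0 1 ×ˢ Set.Icc a b) = ENNReal.ofReal (b - a) ∧
      μ (Set.Icc a b ×ˢ Set.Icc 0 1) = ENNReal.ofReal (b - a)

/-- The square `i - 1 ≤ n x ≤ i`, `u(i) - 1 ≤ n y ≤ u(i)` of the plot of `u`; since `Fin n` starts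
at `0`, the element `j : Fin n` stands for `i = j + 1`. -/
def plotSquare {n : ℕ} (u : Equiv.Perm (Fin n)) (j : Fin n) : Set (ℝ × ℝ) :=
  {p | (j : ℝ) ≤ n * p.1 ∧ n * p.1 ≤ (j : ℝ) + 1 ∧
    ((u j : ℕ) : ℝ) ≤ n * p.2 ∧ n * p.2 ≤ ((u j : ℕ) : ℝ) + 1}

/-- The permuton `π_u`: density `n` on the squares of the plot of `u`, density `0` elsewhere. -/
def permPermuton {n : ℕ} (u : Equiv.Perm (Fin n)) : Measure (ℝ × ℝ) :=
  (n : ℝ≥0∞) • volume.restrict (⋃ j : Fin n, plotSquare u j)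

/-- Weak convergence of finite measures on the plane, in Mathlib's topology on `FiniteMeasure`
(that is, convergence of integrals of bounded continuous functions). -/
def ConvergesWeakly (μ : ℕ → Measure (ℝ × ℝ)) (ν : Measure (ℝ × ℝ)) : Prop :=
  ∃ (hμ : ∀ n, IsFiniteMeasure (μ n)) (hν : IsFiniteMeasure ν),
    Tendsto (β := FiniteMeasure (ℝ × ℝ)) (fun n => ⟨μ n, hμ n⟩) atTop
      (nhds (X := FiniteMeasure (ℝ × ℝ)) ⟨ν, hν⟩)

/-! ### The measures `ν^{α,β}` -/

/-- The quotient `a / b`, where `a / 0` is read as `∞`. -/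
def quot (a b : ℝ) : EReal := if b = 0 then ⊤ else ((a / b : ℝ) : EReal)

/-- The height `1 - α / ((1 - β) (1 - x) + α)` of the lower right curve. -/
def curveSE (α β x : ℝ) : ℝ := 1 - α / ((1 - β) * (1 - x) + α)

/-- The height `α / (β x + α)` of the upper left curve. -/
def curveNW (α β x : ℝ) : ℝ := α / (β * x + α)

/-- The abscissas of the lower right curve: `max {α/(1-β), 1 - α/β} ≤ x ≤ 1`. -/
def rangeSE (α β : ℝ) : Set ℝ :=
  {x | x ∈ Set.Icc (0 : ℝ) 1 ∧ max (quot α (1 - β)) (1 - quot α β) ≤ (x : EReal)}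

/-- The abscissas of the upper left curve: `0 ≤ x ≤ min {α/(1-β), 1 - α/β}`. -/
def rangeNW (α β : ℝ) : Set ℝ :=
  {x | x ∈ Set.Icc (0 : ℝ) 1 ∧ (x : EReal) ≤ min (quot α (1 - β)) (1 - quot α β)}

/-- The abscissas of the antidiagonal segment: `1 - α/β ≤ x ≤ α/(1-β)`. -/
def rangeDiag (α β : ℝ) : Set ℝ :=
  {x | x ∈ Set.Icc (0 : ℝ) 1 ∧ 1 - quot α β ≤ (x : EReal) ∧ (x : EReal) ≤ quot α (1 - β)}

/-- The region below the lower right curve. -/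
def regionSE (α β : ℝ) : Set (ℝ × ℝ) :=
  {p | p.1 ∈ Set.Icc (0 : ℝ) 1 ∧ p.2 ∈ Set.Icc (0 : ℝ) 1 ∧
    quot α (1 - β) ≤ (p.1 : EReal) ∧
    (p.2 : EReal) ≤ min ((1 - β : ℝ) : EReal) (1 - quot α (1 - β)) ∧
    p.2 ≤ curveSE α β p.1}

/-- The region above the upper left curve. -/
def regionNW (α β : ℝ) : Set (ℝ × ℝ) :=
  {p | p.1 ∈ Set.Icc (0 : ℝ) 1 ∧ p.2 ∈ Set.Icc (0 : ℝ) 1 ∧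
    (p.1 : EReal) ≤ 1 - quot α β ∧
    max ((1 - β : ℝ) : EReal) (quot α β) ≤ (p.2 : EReal) ∧
    curveNW α β p.1 ≤ p.2}

/-- The measure `A ↦ ∫_{x ∈ I, (x, g x) ∈ A} f x dx` carried by the graph of `g` over `I`. -/
def graphMeasure (I : Set ℝ) (f g : ℝ → ℝ) : Measure (ℝ × ℝ) :=
  ((volume.restrict I).withDensity (fun x => ENNReal.ofReal (f x))).map (fun x => (x, g x))

/-- The measure `ν^{α,β}`: Lebesgue measure on the two regions, plus a singular part on the two
curves and on the antidiagonal segment. The weights of the curves with respect to `dx` are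
`α / ((1-β)(1-x) + α)` and `α / (βx + α)`, the lengths of the part of the vertical line through `x`
that the region bordered by the curve leaves free. -/
def nu (α β : ℝ) : Measure (ℝ × ℝ) :=
  volume.restrict (regionSE α β ∪ regionNW α β)
    + graphMeasure (rangeSE α β) (fun x => α / ((1 - β) * (1 - x) + α)) (curveSE α β)
    + graphMeasure (rangeNW α β) (fun x => α / (β * x + α)) (curveNW α β)
    + graphMeasure (rangeDiag α β) (fun _ => 1) (fun x => 1 - x)

/-- `v` is a uniformly random permutation in `S_n`, defined on the probability space `(Ω, P)`. -/
def IsUniformPerm {Ω : Type*} [MeasurableSpace Ω] (P : Measure Ω) {n : ℕ}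
    (v : Ω → Equiv.Perm (Fin n)) : Prop :=
  ∀ σ : Equiv.Perm (Fin n), MeasurableSet {ω | v ω = σ} ∧
    P {ω | v ω = σ} = ((n.factorial : ℝ≥0∞))⁻¹

end

end BubblePermuton

namespace BubblePermuton

/-! Everything is read off the counting function `countBelow u k p`, the number of columns before
`p` with entry below `k`. The operator `tau i` changes it only at `p = i`, where the new value is
the maximum of the left neighbour and the right neighbour minus one (`countBelow_tau_self`). This is
a max-plus recursion over boxes: the value at the upper right vertex of a box comes from the two
adjacent vertices. On a rectangle the recursion is solved explicitly, because counting functions are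
nondecreasing with increments at most one. So the sorted permutation has as its count the maximum of
only two shifted counts of the original one (`countBelow_tauWord_rectangle`).

For uniform permutations the counts are hypergeometric. A Chernoff bound, a union bound over all
corners and Borel–Cantelli give, almost surely, count `/ n → x * y` uniformly in the corner
(`ae_isEquidistributed`); no independence between different `n` is needed. Substituting this limit
into the two-term maximum yields the distribution function `limitCdf`.

It remains to recognise `limitCdf` as the distribution function of `nu`. For `α = β(1-β)` the
antidiagonal part is null, and `nu` disintegrates over vertical lines: on each fibre it is Lebesgue
measure on one side of a curve plus an atom on the curve carrying the missing mass. Integrating the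
fibres gives `nu_Iic`, and convergence of distribution functions implies weak convergence. -/

/-! ### Sorting operators and inversions -/

lemma swap_lt_swap_of_lt {n : ℕ} {a b : Fin n} (hab : (b : ℕ) = a + 1) {q r : Fin n} (hqr : q < r)
    (hne : ¬ (q = a ∧ r = b)) : Equiv.swap a b q < Equiv.swap a b r := by
  simp only [Equiv.swap_apply_def, Fin.lt_def, Fin.ext_iff] at *
  split_ifs <;> omega

/-- Since inversions are recorded as pairs of values, the inversion set of `u` is literally a subset
of the new one: the swap preserves the order of every pair of positions except `(a, b)`, which is
not an inversion of `u`. The pair `(u a, u b)` is the gain. -/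
lemma invCount_lt_of_lt {n : ℕ} (u : Equiv.Perm (Fin n)) {a b : Fin n} (hab : (b : ℕ) = a + 1)
    (h : u a < u b) : invCount u < invCount (u * Equiv.swap a b) := by
  have hlt : a < b := by rw [Fin.lt_def]; omega
  apply Finset.card_lt_card
  rw [Finset.ssubset_iff_of_subset]
  · refine ⟨(u a, u b), ?_, ?_⟩
    · simp [h, hlt]
    · simp [hlt.le]
  · rintro ⟨x, y⟩ hp
    simp only [Finset.mem_filter, Finset.mem_univ, true_and, mul_inv_rev, Equiv.swap_inv,
      Equiv.Perm.mul_apply] at hp ⊢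
    refine ⟨hp.1, swap_lt_swap_of_lt hab hp.2 ?_⟩
    rintro ⟨h1, h2⟩
    rw [Equiv.Perm.inv_eq_iff_eq] at h1 h2
    rw [h1, h2] at hp
    exact absurd hp.1 h.not_gt

lemma tau_eq {n : ℕ} (i : ℤ) (h1 : 1 ≤ i) (h2 : i ≤ (n : ℤ) - 1) (u : Equiv.Perm (Fin n))
    {a b : Fin n} (ha : (a : ℤ) = i - 1) (hb : (b : ℤ) = i) :
    tau i u = if u a < u b then u * Equiv.swap a b else u := by
  have hs : simpleTransposition n i = Equiv.swap a b := by
    rw [simpleTransposition, dif_pos ⟨h1, h2⟩]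
    congr 1 <;> ext <;> simp only [] <;> omega
  have hab : (b : ℕ) = a + 1 := by omega
  rw [tau, hs]
  by_cases h : u a < u b
  · rw [if_pos (invCount_lt_of_lt u hab h), if_pos h]
  · rw [if_neg h, if_neg]
    have hne : u b < u a := lt_of_le_of_ne (not_lt.1 h) (by
      intro h'
      have := u.injective h'
      rw [this] at hab
      omega)
    have := invCount_lt_of_lt (u * Equiv.swap a b) hab (by simpa using hne)
    rw [mul_assoc, Equiv.swap_mul_self, mul_one] at this
    exact this.not_gt

/-! ### Counting functions and the local rule -/

/-- The number of points of the plot of `u` in the first `p` columns and the first `k` rows. -/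
def countBelow {n : ℕ} (u : Equiv.Perm (Fin n)) (k : ℕ) (p : ℤ) : ℕ :=
  (Finset.univ.filter (fun j : Fin n => (j : ℤ) < p ∧ (u j : ℕ) < k)).card

lemma countBelow_mono {n : ℕ} (u : Equiv.Perm (Fin n)) (k : ℕ) : Monotone (countBelow u k) := by
  intro p q hpq
  apply Finset.card_le_card
  intro j
  simp only [Finset.mem_filter, Finset.mem_univ, true_and]
  exact fun h => ⟨h.1.trans_le hpq, h.2⟩

lemma countBelow_of_nonpos {n : ℕ} (u : Equiv.Perm (Fin n)) (k : ℕ) {p : ℤ} (hp : p ≤ 0) :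
    countBelow u k p = 0 := by
  rw [countBelow, Finset.card_eq_zero, Finset.filter_eq_empty_iff]
  rintro j - ⟨h, -⟩
  omega

lemma countBelow_succ {n : ℕ} (u : Equiv.Perm (Fin n)) (k : ℕ) (p : Fin n) :
    countBelow u k ((p : ℤ) + 1) = countBelow u k p + if (u p : ℕ) < k then 1 else 0 := by
  have : Finset.univ.filter (fun j : Fin n => (j : ℤ) < (p : ℤ) + 1 ∧ (u j : ℕ) < k) =
      Finset.univ.filter (fun j : Fin n => (j : ℤ) < p ∧ (u j : ℕ) < k) ∪
        (if (u p : ℕ) < k then {p} else ∅) := by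
    ext j
    simp only [Finset.mem_filter, Finset.mem_univ, true_and, Finset.mem_union]
    split_ifs with h
    · rw [Finset.mem_singleton]
      constructor
      · rintro ⟨h1, h2⟩
        by_cases hj : j = p
        · exact Or.inr hj
        · rw [Fin.ext_iff] at hj
          exact Or.inl ⟨by omega, h2⟩
      · rintro (⟨h1, h2⟩ | rfl)
        · exact ⟨by omega, h2⟩
        · exact ⟨by omega, h⟩
    · simp only [Finset.notMem_empty, or_false]
      constructor
      · rintro ⟨h1, h2⟩
        have hj : j ≠ p := by rintro rfl; exact h h2
        rw [Ne, Fin.ext_iff] at hj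
        exact ⟨by omega, h2⟩
      · rintro ⟨h1, h2⟩
        exact ⟨by omega, h2⟩
  rw [countBelow, this, Finset.card_union_of_disjoint, countBelow]
  · split_ifs <;> simp
  · split_ifs <;> simp

lemma countBelow_add_one_le {n : ℕ} (u : Equiv.Perm (Fin n)) (k : ℕ) (p : ℤ) :
    countBelow u k (p + 1) ≤ countBelow u k p + 1 := by
  by_cases h : 0 ≤ p ∧ p < n
  · have := countBelow_succ u k ⟨p.toNat, by omega⟩
    simp only [Int.toNat_of_nonneg h.1] at this
    rw [this]
    split_ifs <;> omega
  · apply (Finset.card_le_card _).trans (Nat.le_succ _)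
    intro j
    simp only [Finset.mem_filter, Finset.mem_univ, true_and]
    exact fun h => ⟨by omega, h.2⟩

lemma countBelow_mul_swap {n : ℕ} (u : Equiv.Perm (Fin n)) (k : ℕ) {a b : Fin n}
    (hab : (b : ℕ) = a + 1) {p : ℤ} (hp : p ≠ b) :
    countBelow (u * Equiv.swap a b) k p = countBelow u k p := by
  have hlt : ∀ j : Fin n, (j : ℤ) < p → ((Equiv.swap a b j : Fin n) : ℤ) < p := by
    intro j h1
    rw [Equiv.swap_apply_def]
    split_ifs with h3 h4
    · rw [h3] at h1; omega
    · rw [h4] at h1; omega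
    · exact h1
  rw [countBelow, countBelow]
  refine Finset.card_bij (fun j _ => Equiv.swap a b j) (fun j hj => ?_)
    (fun _ _ _ _ h => (Equiv.swap a b).injective h) (fun j hj => ?_)
  · have hj := (Finset.mem_filter.1 hj).2
    exact Finset.mem_filter.2 ⟨Finset.mem_univ _, hlt j hj.1, hj.2⟩
  · have hj := (Finset.mem_filter.1 hj).2
    refine ⟨Equiv.swap a b j, Finset.mem_filter.2 ⟨Finset.mem_univ _, hlt j hj.1, ?_⟩, by simp⟩
    simpa using hj.2

lemma countBelow_tau_of_ne {n : ℕ} (u : Equiv.Perm (Fin n)) (k : ℕ) {i p : ℤ} (h1 : 1 ≤ i)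
    (h2 : i ≤ (n : ℤ) - 1) (hp : p ≠ i) : countBelow (tau i u) k p = countBelow u k p := by
  have ha : ((⟨(i - 1).toNat, by omega⟩ : Fin n) : ℤ) = i - 1 := by simp only []; omega
  have hb : ((⟨i.toNat, by omega⟩ : Fin n) : ℤ) = i := by simp only []; omega
  rw [tau_eq i h1 h2 u ha hb]
  split_ifs
  · exact countBelow_mul_swap u k (by omega) (by omega)
  · rfl

/-- The local rule for the action of `τ_i` on the counting function. -/
lemma countBelow_tau_self {n : ℕ} (u : Equiv.Perm (Fin n)) (k : ℕ) {i : ℤ} (h1 : 1 ≤ i)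
    (h2 : i ≤ (n : ℤ) - 1) :
    countBelow (tau i u) k i = max (countBelow u k (i - 1)) (countBelow u k (i + 1) - 1) := by
  obtain ⟨a, ha⟩ : ∃ a : Fin n, (a : ℤ) = i - 1 := ⟨⟨(i - 1).toNat, by omega⟩, by simp only []; omega⟩
  obtain ⟨b, hb⟩ : ∃ b : Fin n, (b : ℤ) = i := ⟨⟨i.toNat, by omega⟩, by simp only []; omega⟩
  have e1 := countBelow_succ (tau i u) k a
  have e2 := countBelow_succ u k a
  have e3 := countBelow_succ u k b
  rw [ha, sub_add_cancel] at e1 e2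
  rw [hb] at e3
  rw [countBelow_tau_of_ne u k h1 h2 (p := i - 1) (by omega)] at e1
  rw [e1, e3, e2, tau_eq i h1 h2 u ha hb]
  -- After `tau i` the larger entry stands at `a`, so column `a` is counted iff both entries are
  -- below `k`. The increment there is the minimum of the two old increments, which equals `max 0
  -- (sum - 1)`. Truncated subtraction is harmless inside a maximum of naturals.
  by_cases h : u a < u b
  · rw [if_pos h]
    simp only [Equiv.Perm.mul_apply, Equiv.swap_apply_left]
    rw [Fin.lt_def] at h
    split_ifs <;> omega
  · rw [if_neg h]
    rw [Fin.lt_def] at h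
    split_ifs <;> omega

/-! ### The max-plus recursion on a rectangle -/

/-- `(x, y)` lies on the path that bounds the boxes of `l` inside the rectangle with lower left
vertex `(a, b)`. -/
def OnBoundary (a b : ℤ) (w h : ℕ) (l : List (ℤ × ℤ)) (x y : ℤ) : Prop :=
  (a ≤ x ∧ x ≤ a + w ∧ b ≤ y ∧ y ≤ b + h) ∧ (x = a ∨ y = b ∨ (x - 1, y - 1) ∈ l) ∧ (x, y) ∉ l

/-- The counting function along the boundary of an order ideal of a rectangle. -/
lemma countBelow_tauWord_of_onBoundary {n : ℕ} (v : Equiv.Perm (Fin n)) (k : ℕ) {a b : ℤ} {w h : ℕ}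
    (hab : a - b = h) (l : List (ℤ × ℤ)) (m : List (ℤ × ℤ))
    (hl : IsLinearExtension (Finset.Ico a (a + w) ×ˢ Finset.Ico b (b + h)) (l ++ m))
    (hc : ∀ c ∈ l, 1 ≤ content c ∧ content c ≤ (n : ℤ) - 1) (x y : ℤ)
    (hxy : OnBoundary a b w h l x y) :
    (countBelow (tauWord (l.map content) v) k (x - y) : ℤ) =
      max (countBelow v k (a - y) : ℤ) (countBelow v k (x - b) - (y - b)) := by
  induction l using List.reverseRecOn generalizing m x y with
  | nil =>
    obtain ⟨⟨h1, h2, h3, h4⟩, h5, -⟩ := hxy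
    simp only [List.map_nil, tauWord, List.foldl_nil]
    have hlip : ∀ d : ℕ, ∀ p : ℤ, countBelow v k (p + d) ≤ countBelow v k p + d := by
      intro d p
      induction d with
      | zero => simp
      | succ d ih =>
        have := countBelow_add_one_le v k (p + d)
        push_cast
        rw [← add_assoc]
        omega
    rcases h5 with rfl | rfl | h5
    · have := hlip (y - b).toNat (x - y)
      rw [Int.toNat_of_nonneg (by omega)] at this
      rw [show x - y + (y - b) = x - b by ring] at this
      omega
    · have := countBelow_mono v k (show a - y ≤ x - y by omega)
      omega
    · simp at h5
  | append_singleton l c ih =>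
    obtain ⟨X, Y⟩ := c
    rw [List.append_assoc, List.singleton_append] at hl
    have ih := ih ((X, Y) :: m) hl (fun c hc' => hc c (by simp [hc']))
    obtain ⟨hnd, hmem, hpw⟩ := hl
    have hXY : (X, Y) ∈ Finset.Ico a (a + w) ×ˢ Finset.Ico b (b + h) := (hmem _).1 (by simp)
    simp only [Finset.mem_product, Finset.mem_Ico] at hXY
    have hcc := hc (X, Y) (by simp)
    rw [List.pairwise_append] at hpw
    obtain ⟨-, hpw2, hpw3⟩ := hpw
    rw [List.pairwise_cons] at hpw2
    have hXl : (X, Y) ∉ l := by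
      intro h'
      rw [List.nodup_append] at hnd
      exact hnd.2.2 _ h' _ (by simp) rfl
    -- smaller boxes come earlier, larger boxes come later
    have hsmall : ∀ x' y', a ≤ x' → b ≤ y' → x' ≤ X → y' ≤ Y → (x', y') ≠ (X, Y) →
        (x', y') ∈ l := by
      intro x' y' h1 h2 h3 h4 h5
      have : (x', y') ∈ l ++ (X, Y) :: m := by
        rw [hmem]
        simp only [Finset.mem_product, Finset.mem_Ico]
        omega
      rw [List.mem_append, List.mem_cons] at this
      rcases this with h | h | h
      · exact h
      · exact absurd h h5
      · exact absurd (Prod.mk_le_mk.2 ⟨h3, h4⟩) (hpw2.1 _ h)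
    have hlarge : ∀ x' y', X ≤ x' → Y ≤ y' → (x', y') ∉ l := by
      intro x' y' h1 h2 h3
      exact hpw3 _ h3 (X, Y) (by simp) (Prod.mk_le_mk.2 ⟨h1, h2⟩)
    have hfold : tauWord ((l ++ [(X, Y)]).map content) v =
        tau (X - Y) (tauWord (l.map content) v) := by
      simp [tauWord, content]
    rw [hfold]
    simp only [content] at hcc
    obtain ⟨hr, hb1, hb2⟩ := hxy
    simp only [List.mem_append, List.mem_singleton, Prod.mk.injEq, not_or] at hb1 hb2
    by_cases hd : x - y = X - Y
    · have hx : x = X + 1 ∧ y = Y + 1 := by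
        rcases lt_trichotomy x (X + 1) with h' | h' | h'
        · by_cases hX : x = X
          · exact absurd ⟨hX, by omega⟩ hb2.2
          · exact absurd (hsmall x y (by omega) (by omega) (by omega) (by omega)
              (by rw [Ne, Prod.mk.injEq]; omega)) hb2.1
        · omega
        · rcases hb1 with h1 | h1 | h1 | h1
          · omega
          · omega
          · exact absurd h1 (hlarge _ _ (by omega) (by omega))
          · omega
      obtain ⟨rfl, rfl⟩ := hx
      rw [show X + 1 - (Y + 1) = X - Y by ring, countBelow_tau_self _ k hcc.1 hcc.2]
      have b1 := ih X (Y + 1) ⟨by omega, by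
          by_cases hX : X = a
          · exact Or.inl hX
          · exact Or.inr (Or.inr (hsmall _ _ (by omega) (by omega) (by omega) (by omega)
              (by rw [Ne, Prod.mk.injEq]; omega))), hlarge _ _ (by omega) (by omega)⟩
      have b2 := ih (X + 1) Y ⟨by omega, by
          by_cases hX : Y = b
          · exact Or.inr (Or.inl hX)
          · exact Or.inr (Or.inr (hsmall _ _ (by omega) (by omega) (by omega) (by omega)
              (by rw [Ne, Prod.mk.injEq]; omega))), hlarge _ _ (by omega) (by omega)⟩
      rw [show X - (Y + 1) = X - Y - 1 by ring] at b1
      rw [show X + 1 - Y = X - Y + 1 by ring] at b2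
      -- The recursion produces four terms. Monotonicity and the unit bound on increments show that
      -- the two crossed ones are dominated by the two that are wanted.
      have m1 := countBelow_mono v k (show X - b ≤ X + 1 - b by omega)
      have m2 := countBelow_add_one_le v k (a - (Y + 1))
      rw [show a - (Y + 1) + 1 = a - Y by ring] at m2
      omega
    · rw [countBelow_tau_of_ne _ k hcc.1 hcc.2 hd]
      refine ih x y ⟨hr, ?_, hb2.1⟩
      rcases hb1 with h1 | h1 | h1 | h1
      · exact Or.inl h1
      · exact Or.inr (Or.inl h1)
      · exact Or.inr (Or.inr h1)
      · omega

/-- The counting function after sorting along a full rectangle. -/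
lemma countBelow_tauWord_rectangle {n h w : ℕ} (hn : h + w = n) {S : Finset (ℤ × ℤ)}
    (hS : IsRectangle S h w) (hc : ∀ c ∈ S, 1 ≤ content c ∧ content c ≤ (n : ℤ) - 1)
    {word : List ℤ} (hw : IsWordOfShape S word) (v : Equiv.Perm (Fin n)) {k p : ℕ}
    (hp : p ≤ n) :
    countBelow (tauWord word v) k p =
      max (countBelow v k ((p - w : ℕ) : ℤ))
        (countBelow v k ((min (p + h) n : ℕ) : ℤ) - min h (n - p)) := by
  obtain ⟨l, hl, rfl⟩ := hw
  -- The upper left box has content at least `1` and the lower right one at most `n - 1`; with `h +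
  -- w = n` this forces `a - b = h`. An empty rectangle may be placed anywhere.
  obtain ⟨a, b, hab, rfl⟩ : ∃ a b : ℤ, a - b = h ∧
      S = Finset.Ico a (a + w) ×ˢ Finset.Ico b (b + h) := by
    obtain ⟨a, b, hab⟩ := hS
    by_cases h0 : 0 < h ∧ 0 < w
    · refine ⟨a, b, ?_, hab⟩
      have h1 := hc (a, b + h - 1) (by
        rw [hab]; simp only [Finset.mem_product, Finset.mem_Ico]; omega)
      have h2 := hc (a + w - 1, b) (by
        rw [hab]; simp only [Finset.mem_product, Finset.mem_Ico]; omega)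
      simp only [content] at h1 h2
      omega
    · refine ⟨h, 0, by omega, ?_⟩
      rw [hab]
      rcases Nat.eq_zero_or_pos h with rfl | h'
      · simp
      · obtain rfl : w = 0 := by omega
        simp
  have key := countBelow_tauWord_of_onBoundary v k hab l [] (by simpa using hl)
    (fun c hc' => hc c ((hl.2.1 c).1 hc'))
  -- The final path is the top edge followed by the right edge. On the top edge the first term is
  -- the count at `0`; on the right edge the second is the count at `n`.
  rcases le_total p w with hpw | hpw
  · have := key (b + h + p) (b + h) ⟨by omega, by
      by_cases hp0 : p = 0
      · left; omega
      by_cases hh0 : h = 0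
      · right; left; omega
      right; right
      rw [hl.2.1]; simp only [Finset.mem_product, Finset.mem_Ico]; omega, by
      rw [hl.2.1]; simp only [Finset.mem_product, Finset.mem_Ico]; omega⟩
    rw [show b + h + p - (b + h) = (p : ℤ) by ring, show b + h + p - b = ((p + h : ℕ) : ℤ) by push_cast; ring,
      countBelow_of_nonpos v k (show a - (b + h) ≤ 0 by omega)] at this
    rw [Nat.sub_eq_zero_of_le hpw, countBelow_of_nonpos v k (by simp : ((0 : ℕ) : ℤ) ≤ 0),
      min_eq_left (by omega : p + h ≤ n), min_eq_left (by omega : h ≤ n - p)]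
    omega
  · have := key (a + w) (b + (n - p : ℕ)) ⟨by omega, by
      by_cases hp0 : p = n
      · right; left; omega
      by_cases hh0 : w = 0
      · left; omega
      right; right
      rw [hl.2.1]; simp only [Finset.mem_product, Finset.mem_Ico]; omega, by
      rw [hl.2.1]; simp only [Finset.mem_product, Finset.mem_Ico]; omega⟩
    rw [show a + w - (b + (n - p : ℕ)) = (p : ℤ) by omega,
      show a - (b + (n - p : ℕ)) = ((p - w : ℕ) : ℤ) by omega,
      show a + w - b = (n : ℤ) by omega] at this
    rw [min_eq_right (by omega : n ≤ p + h), min_eq_right (by omega : n - p ≤ h)]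
    omega

/-! ### Concentration for sampling without replacement -/

/-- The number of permutations that map `T` into `K`. -/
def mapsCount {n : ℕ} (T K : Finset (Fin n)) : ℕ :=
  (Finset.univ.filter (fun σ : Equiv.Perm (Fin n) => ∀ q ∈ T, σ q ∈ K)).card

lemma mapsCount_insert_eq {n : ℕ} {T K : Finset (Fin n)} {q q' : Fin n} (hq : q ∉ T)
    (hq' : q' ∉ T) : mapsCount (insert q T) K = mapsCount (insert q' T) K := by
  have hmaps : ∀ {q q' : Fin n}, q ∉ T → q' ∉ T → ∀ σ : Equiv.Perm (Fin n),
      (∀ r ∈ insert q T, σ r ∈ K) → ∀ r ∈ insert q' T, (σ * Equiv.swap q q') r ∈ K := by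
    intro q q' hq hq' σ hσ r hr
    rw [Finset.mem_insert] at hr
    rw [Equiv.Perm.mul_apply]
    rcases hr with rfl | hr
    · rw [Equiv.swap_apply_right]
      exact hσ _ (Finset.mem_insert_self _ _)
    · rw [Equiv.swap_apply_of_ne_of_ne (by rintro rfl; exact hq hr) (by rintro rfl; exact hq' hr)]
      exact hσ _ (Finset.mem_insert_of_mem hr)
  rw [mapsCount, mapsCount]
  refine Finset.card_bij (fun σ _ => σ * Equiv.swap q q') (fun σ hσ => ?_)
    (fun _ _ _ _ h => mul_right_cancel h) (fun σ hσ => ?_)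
  · exact Finset.mem_filter.2 ⟨Finset.mem_univ _, hmaps hq hq' σ (Finset.mem_filter.1 hσ).2⟩
  · refine ⟨σ * Equiv.swap q' q, Finset.mem_filter.2 ⟨Finset.mem_univ _,
      hmaps hq' hq σ (Finset.mem_filter.1 hσ).2⟩, ?_⟩
    rw [mul_assoc, Equiv.swap_comm q' q, Equiv.swap_mul_self, mul_one]

/-- Double counting of pairs `(σ, q')` with `q'` outside `T` and `σ` mapping `T ∪ {q'}` into `K`. By
symmetry each `q'` contributes equally; each `σ` mapping `T` into `K` leaves `|K| - |T|` choices of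
`q'`. -/
lemma mapsCount_insert_mul {n : ℕ} {T K : Finset (Fin n)} {q : Fin n} (hq : q ∉ T) :
    (n - T.card) * mapsCount (insert q T) K = mapsCount T K * (K.card - T.card) := by
  have h1 : ∑ q' ∈ Tᶜ, mapsCount (insert q' T) K = (n - T.card) * mapsCount (insert q T) K := by
    rw [Finset.sum_congr rfl (fun q' hq' =>
      (mapsCount_insert_eq (K := K) (Finset.mem_compl.1 hq') hq)), Finset.sum_const,
      Finset.card_compl, Fintype.card_fin, smul_eq_mul]
  rw [← h1]
  have h2 : ∀ q' : Fin n, mapsCount (insert q' T) K =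
      ∑ σ ∈ Finset.univ.filter (fun σ : Equiv.Perm (Fin n) => ∀ q ∈ T, σ q ∈ K),
        if σ q' ∈ K then 1 else 0 := by
    intro q'
    rw [mapsCount, ← Finset.card_filter, Finset.filter_filter]
    congr 1
    ext σ
    simp only [Finset.mem_filter, Finset.mem_univ, true_and, Finset.mem_insert, forall_eq_or_imp]
    exact and_comm
  simp_rw [h2]
  rw [Finset.sum_comm, mapsCount, ← smul_eq_mul, ← Finset.sum_const]
  refine Finset.sum_congr rfl (fun σ hσ => ?_)
  have hσ := (Finset.mem_filter.1 hσ).2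
  rw [← Finset.card_filter]
  have h3 : Tᶜ.filter (fun q' => σ q' ∈ K) = (K.map σ⁻¹.toEmbedding) \ T := by
    ext r
    simp only [Finset.mem_filter, Finset.mem_compl, Finset.mem_sdiff, Finset.mem_map,
      Equiv.coe_toEmbedding]
    constructor
    · rintro ⟨h, h'⟩
      exact ⟨⟨σ r, h', by simp⟩, h⟩
    · rintro ⟨⟨s, hs, rfl⟩, h⟩
      exact ⟨h, by simpa using hs⟩
  rw [h3, Finset.card_sdiff_of_subset, Finset.card_map]
  intro r hr
  simp only [Finset.mem_map, Equiv.coe_toEmbedding]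
  exact ⟨σ r, hσ r hr, by simp⟩

/-- Negative dependence: once `T` has used up places of `K`, the next point falls into `K` with
probability `(|K| - |T|) / (n - |T|) ≤ |K| / n`. -/
lemma mapsCount_le {n : ℕ} (T K : Finset (Fin n)) :
    (mapsCount T K : ℝ) ≤ n.factorial * ((K.card : ℝ) / n) ^ T.card := by
  induction T using Finset.induction_on with
  | empty => simp [mapsCount, Fintype.card_perm]
  | insert q T hq ih =>
    have hn : 0 < n := q.pos
    have hT : T.card < n := by
      have := Finset.card_lt_univ_of_notMem hq
      simpa using this
    have hK : K.card ≤ n := by simpa using Finset.card_le_univ K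
    rw [Finset.card_insert_of_notMem hq, pow_succ, ← mul_assoc]
    have hstep : (mapsCount (insert q T) K : ℝ) ≤ mapsCount T K * ((K.card : ℝ) / n) := by
      have h := mapsCount_insert_mul (K := K) hq
      have h' : (n - T.card) * (n * mapsCount (insert q T) K) ≤
          (n - T.card) * (mapsCount T K * K.card) := by
        calc (n - T.card) * (n * mapsCount (insert q T) K)
            = n * (mapsCount T K * (K.card - T.card)) := by rw [← h]; ring
          _ = mapsCount T K * (n * (K.card - T.card)) := by ring
          _ ≤ mapsCount T K * ((n - T.card) * K.card) := by
              apply Nat.mul_le_mul_left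
              rw [Nat.mul_sub, Nat.sub_mul]
              have := Nat.mul_le_mul_left T.card hK
              rw [Nat.mul_comm n T.card]
              omega
          _ = _ := by ring
      have h'' := Nat.le_of_mul_le_mul_left h' (by omega)
      rw [mul_div_assoc', le_div_iff₀ (by exact_mod_cast hn), mul_comm]
      exact_mod_cast h''
    exact hstep.trans (mul_le_mul_of_nonneg_right ih (by positivity))

/-- The moment generating function of a hypergeometric variable is at most that of a binomial
one. -/
lemma sum_prod_one_add_le {n : ℕ} (Q K : Finset (Fin n)) {s : ℝ} (hs : 0 ≤ s) :
    ∑ σ : Equiv.Perm (Fin n), ∏ q ∈ Q, (1 + if σ q ∈ K then s else 0) ≤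
      n.factorial * (1 + s * (K.card / n)) ^ Q.card := by
  -- Expanding over subsets `T` of `Q` gives nonnegative coefficients, so `mapsCount_le` applies
  -- term by term and the binomial theorem resums.
  simp_rw [Finset.prod_one_add]
  rw [Finset.sum_comm]
  have h1 : ∀ T ∈ Q.powerset, ∑ σ : Equiv.Perm (Fin n), ∏ q ∈ T, (if σ q ∈ K then s else 0) ≤
      n.factorial * (s * (K.card / n)) ^ T.card := by
    intro T _
    have : ∀ σ : Equiv.Perm (Fin n), ∏ q ∈ T, (if σ q ∈ K then s else 0) =
        if ∀ q ∈ T, σ q ∈ K then s ^ T.card else 0 := by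
      intro σ
      rw [Finset.prod_ite_zero, Finset.prod_const]
      congr
    simp_rw [this]
    rw [← Finset.sum_filter, Finset.sum_const, nsmul_eq_mul, mul_pow]
    calc _ ≤ (n.factorial * ((K.card : ℝ) / n) ^ T.card) * s ^ T.card :=
          mul_le_mul_of_nonneg_right (mapsCount_le T K) (by positivity)
      _ = _ := by ring
  refine (Finset.sum_le_sum h1).trans_eq ?_
  rw [← Finset.mul_sum]
  congr 1
  rw [← Finset.prod_const, Finset.prod_one_add]
  simp

/-- From `exp t - 1 ≤ t + t ^ 2` on `[0, 1]`, `r ≤ 1` and `1 + z ≤ exp z`. -/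
lemma one_add_mul_exp_sub_one_le {r t : ℝ} (hr0 : 0 ≤ r) (hr1 : r ≤ 1) (ht0 : 0 ≤ t)
    (ht1 : t ≤ 1) : 1 + (Real.exp t - 1) * r ≤ Real.exp (r * t + t ^ 2) := by
  have h := Real.abs_exp_sub_one_sub_id_le (x := t) (by rwa [abs_of_nonneg ht0])
  have h1 := (abs_le.1 h).2
  have h2 := Real.add_one_le_exp (r * t + t ^ 2)
  nlinarith [sq_nonneg t]

/-- A Chernoff bound for sampling without replacement. -/
lemma card_upper_deviation_le {n : ℕ} (Q K : Finset (Fin n)) {ε : ℝ} (h0 : 0 < ε) (h1 : ε ≤ 1) :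
    ((Finset.univ.filter (fun σ : Equiv.Perm (Fin n) =>
      (Q.card : ℝ) * (K.card / n) + ε * n ≤ (Q.filter (fun q => σ q ∈ K)).card)).card : ℝ) ≤
      n.factorial * Real.exp (-(ε ^ 2 / 4) * n) := by
  -- With `|Q| ≤ n` the exponent is at most `(t ^ 2 - ε t) n`, minimal at `t = ε / 2` with value
  -- `-(ε ^ 2 / 4) n`.
  set t : ℝ := ε / 2 with ht
  set r : ℝ := K.card / n with hr
  have hK : (K.card : ℝ) ≤ n := by exact_mod_cast (by simpa using Finset.card_le_univ K)
  have hQ : (Q.card : ℝ) ≤ n := by exact_mod_cast (by simpa using Finset.card_le_univ Q)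
  have hr0 : 0 ≤ r := by positivity
  have hr1 : r ≤ 1 := div_le_one_of_le₀ hK (by positivity)
  have hs : 0 ≤ Real.exp t - 1 := by
    have := Real.one_le_exp (show 0 ≤ t by positivity)
    linarith
  set A := Finset.univ.filter (fun σ : Equiv.Perm (Fin n) =>
      (Q.card : ℝ) * r + ε * n ≤ (Q.filter (fun q => σ q ∈ K)).card) with hA
  have hprod : ∀ σ : Equiv.Perm (Fin n), ∏ q ∈ Q, (1 + if σ q ∈ K then Real.exp t - 1 else 0) =
      Real.exp (t * (Q.filter (fun q => σ q ∈ K)).card) := by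
    intro σ
    have : ∀ q ∈ Q, (1 + if σ q ∈ K then Real.exp t - 1 else 0) =
        if σ q ∈ K then Real.exp t else 1 := by
      intro q _
      split_ifs <;> ring
    rw [Finset.prod_congr rfl this, ← Finset.prod_filter, Finset.prod_const, ← Real.exp_nat_mul,
      mul_comm]
  have hlow : (A.card : ℝ) * Real.exp (t * (Q.card * r + ε * n)) ≤
      ∑ σ : Equiv.Perm (Fin n), ∏ q ∈ Q, (1 + if σ q ∈ K then Real.exp t - 1 else 0) := by
    simp_rw [hprod]
    calc (A.card : ℝ) * Real.exp (t * (Q.card * r + ε * n))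
        = ∑ σ ∈ A, Real.exp (t * (Q.card * r + ε * n)) := by simp
      _ ≤ ∑ σ ∈ A, Real.exp (t * (Q.filter (fun q => σ q ∈ K)).card) := by
          refine Finset.sum_le_sum (fun σ hσ => ?_)
          have := (Finset.mem_filter.1 hσ).2
          gcongr
      _ ≤ _ := Finset.sum_le_sum_of_subset_of_nonneg (Finset.subset_univ _)
          (fun _ _ _ => (Real.exp_pos _).le)
  have hup := hlow.trans (sum_prod_one_add_le Q K hs)
  have hmgf : (1 + (Real.exp t - 1) * r) ^ Q.card ≤ Real.exp (Q.card * (r * t + t ^ 2)) := by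
    rw [Real.exp_nat_mul]
    have : 0 ≤ (Real.exp t - 1) * r := mul_nonneg hs hr0
    exact pow_le_pow_left₀ (by linarith)
      (one_add_mul_exp_sub_one_le hr0 hr1 (by positivity) (by linarith)) _
  have hfin : (A.card : ℝ) * Real.exp (t * (Q.card * r + ε * n)) ≤
      n.factorial * Real.exp (-(ε ^ 2 / 4) * n) * Real.exp (t * (Q.card * r + ε * n)) := by
    refine (hup.trans (mul_le_mul_of_nonneg_left hmgf (by positivity))).trans ?_
    rw [mul_assoc, ← Real.exp_add]
    gcongr
    rw [ht]
    nlinarith [sq_nonneg ε]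
  exact le_of_mul_le_mul_right hfin (Real.exp_pos _)

lemma card_filter_val_lt {n k : ℕ} (hk : k ≤ n) :
    (Finset.univ.filter (fun j : Fin n => (j : ℕ) < k)).card = k := by
  rw [Fin.card_filter_val_lt, min_eq_right hk]

lemma card_deviation_le {n k p : ℕ} (hk : k ≤ n) (hp : p ≤ n) {ε : ℝ} (h0 : 0 < ε) (h1 : ε ≤ 1) :
    ((Finset.univ.filter (fun σ : Equiv.Perm (Fin n) =>
      ε * n ≤ |(countBelow σ k p : ℝ) - p * k / n|)).card : ℝ) ≤
      2 * (n.factorial * Real.exp (-(ε ^ 2 / 4) * n)) := by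
  set Q := Finset.univ.filter (fun j : Fin n => (j : ℕ) < p)
  set K := Finset.univ.filter (fun j : Fin n => (j : ℕ) < k)
  have hQ : Q.card = p := card_filter_val_lt hp
  have hK : K.card = k := card_filter_val_lt hk
  have hcount : ∀ σ : Equiv.Perm (Fin n), countBelow σ k p = (Q.filter (fun q => σ q ∈ K)).card := by
    intro σ
    rw [countBelow, Finset.filter_filter]
    congr 1
    ext j
    simp [K]
  have hcompl : ∀ σ : Equiv.Perm (Fin n),
      (countBelow σ k p : ℝ) + (Q.filter (fun q => σ q ∈ Kᶜ)).card = p := by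
    intro σ
    rw [hcount, ← hQ, ← Finset.card_filter_add_card_filter_not (s := Q) (fun q => σ q ∈ K)]
    simp
  have b1 := card_upper_deviation_le Q K h0 h1
  -- A lower deviation for `K` is an upper deviation for its complement.
  have b2 := card_upper_deviation_le Q Kᶜ h0 h1
  rw [two_mul]
  refine le_trans ?_ (add_le_add b1 b2)
  rw [← Nat.cast_add, Nat.cast_le]
  refine le_trans (Finset.card_le_card ?_) (Finset.card_union_le _ _)
  intro σ hσ
  have hσ := (Finset.mem_filter.1 hσ).2
  rw [Finset.mem_union, Finset.mem_filter, Finset.mem_filter, Finset.card_compl, Fintype.card_fin,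
    hQ, hK, Nat.cast_sub hk]
  rcases le_abs'.1 hσ with h | h
  · right
    refine ⟨Finset.mem_univ _, ?_⟩
    have := hcompl σ
    rcases Nat.eq_zero_or_pos n with hn | hn
    · obtain rfl : p = 0 := by omega
      simp [hn]
    · have hn' : (n : ℝ) ≠ 0 := by positivity
      rw [sub_div, div_self hn', mul_sub, mul_one, mul_div_assoc']
      linarith
  · left
    refine ⟨Finset.mem_univ _, ?_⟩
    rw [← hcount, mul_div_assoc']
    linarith

/-! ### Almost sure equidistribution -/

/-- The points of the plots of `σ n` are asymptotically equidistributed. -/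
def IsEquidistributed (σ : (n : ℕ) → Equiv.Perm (Fin n)) : Prop :=
  ∀ ε : ℝ, 0 < ε → ∀ᶠ n : ℕ in atTop, ∀ p ≤ n, ∀ k ≤ n,
    |(countBelow (σ n) k p : ℝ) - p * k / n| < ε * n

lemma IsUniformPerm.measure_le {Ω : Type*} [MeasurableSpace Ω] {P : Measure Ω} {n : ℕ}
    {v : Ω → Equiv.Perm (Fin n)} (hv : IsUniformPerm P v) (A : Finset (Equiv.Perm (Fin n)))
    {c : ℝ} (hA : (A.card : ℝ) ≤ n.factorial * c) :
    P {ω | v ω ∈ A} ≤ ENNReal.ofReal c := by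
  have h1 : {ω | v ω ∈ A} = ⋃ σ ∈ A, {ω | v ω = σ} := by
    ext ω; simp
  rw [h1]
  refine (measure_biUnion_finset_le _ _).trans ?_
  rw [Finset.sum_congr rfl (fun σ _ => (hv σ).2), Finset.sum_const, nsmul_eq_mul,
    ← div_eq_mul_inv]
  apply ENNReal.div_le_of_le_mul
  rw [mul_comm, ← ENNReal.ofReal_natCast, ← ENNReal.ofReal_natCast,
    ← ENNReal.ofReal_mul (by positivity)]
  exact ENNReal.ofReal_le_ofReal hA

/-- The union bound over `(n + 1) ^ 2` corners keeps the exponential bound summable. The half of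
Borel–Cantelli used here holds for any joint distribution. -/
lemma ae_eventually_deviation_lt {Ω : Type*} [MeasurableSpace Ω] {P : Measure Ω}
    {v : (n : ℕ) → Ω → Equiv.Perm (Fin n)} (hv : ∀ n, IsUniformPerm P (v n)) {ε : ℝ}
    (h0 : 0 < ε) (h1 : ε ≤ 1) :
    ∀ᵐ ω ∂P, ∀ᶠ n : ℕ in atTop, ∀ p ≤ n, ∀ k ≤ n,
      |(countBelow (v n ω) k p : ℝ) - p * k / n| < ε * n := by
  let A : (n : ℕ) → Finset (Equiv.Perm (Fin n)) := fun n =>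
    (Finset.range (n + 1) ×ˢ Finset.range (n + 1)).biUnion (fun pk =>
      Finset.univ.filter (fun σ : Equiv.Perm (Fin n) =>
        ε * n ≤ |(countBelow σ pk.2 pk.1 : ℝ) - pk.1 * pk.2 / n|))
  have hA : ∀ n, ((A n).card : ℝ) ≤
      n.factorial * (2 * ((n : ℝ) + 1) ^ 2 * Real.exp (-(ε ^ 2 / 4) * n)) := by
    intro n
    have : ((A n).card : ℝ) ≤ ((Finset.range (n + 1) ×ˢ Finset.range (n + 1)).card : ℝ) *
        (2 * (n.factorial * Real.exp (-(ε ^ 2 / 4) * n))) := by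
      rw [← nsmul_eq_mul]
      refine le_trans (Nat.cast_le.2 Finset.card_biUnion_le) ?_
      rw [Nat.cast_sum]
      refine Finset.sum_le_card_nsmul _ _ _ (fun pk hpk => ?_)
      simp only [Finset.mem_product, Finset.mem_range] at hpk
      exact card_deviation_le (by omega) (by omega) h0 h1
    refine this.trans_eq ?_
    rw [Finset.card_product, Finset.card_range]
    push_cast
    ring
  have hsum : Summable (fun n : ℕ =>
      2 * ((n : ℝ) + 1) ^ 2 * Real.exp (-(ε ^ 2 / 4) * n)) := by
    have hpos : 0 < ε ^ 2 / 4 := by positivity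
    have s0 := Real.summable_pow_mul_exp_neg_nat_mul 0 hpos
    have s1 := Real.summable_pow_mul_exp_neg_nat_mul 1 hpos
    have s2 := Real.summable_pow_mul_exp_neg_nat_mul 2 hpos
    refine (((s2.mul_left 2).add (s1.mul_left 4)).add (s0.mul_left 2)).congr (fun n => ?_)
    ring
  have hbc := ae_eventually_notMem (μ := P) (s := fun n => {ω | v n ω ∈ A n}) (by
    refine ne_top_of_le_ne_top hsum.tsum_ofReal_ne_top
      (ENNReal.tsum_le_tsum (fun n => (hv n).measure_le (A n) (hA n))))
  filter_upwards [hbc] with ω hω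
  filter_upwards [hω] with n hn p hp k hk
  by_contra hcon
  apply hn
  simp only [A, Finset.mem_biUnion]
  refine ⟨(p, k), ?_, Finset.mem_filter.2 ⟨Finset.mem_univ _, not_lt.1 hcon⟩⟩
  simp only [Finset.mem_product, Finset.mem_range]
  omega

/-- Uniformly random permutations are almost surely asymptotically equidistributed. -/
lemma ae_isEquidistributed {Ω : Type*} [MeasurableSpace Ω] {P : Measure Ω}
    {v : (n : ℕ) → Ω → Equiv.Perm (Fin n)} (hv : ∀ n, IsUniformPerm P (v n)) :
    ∀ᵐ ω ∂P, IsEquidistributed (fun n => v n ω) := by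
  -- Countably many tolerances suffice, so the exceptional null sets can be united.
  have h : ∀ m : ℕ, ∀ᵐ ω ∂P, ∀ᶠ n : ℕ in atTop, ∀ p ≤ n, ∀ k ≤ n,
      |(countBelow (v n ω) k p : ℝ) - p * k / n| < 1 / ((m : ℝ) + 1) * n := fun m =>
    ae_eventually_deviation_lt hv (by positivity)
      (div_le_one_of_le₀ (by linarith [m.cast_nonneg (α := ℝ)]) (by positivity))
  filter_upwards [ae_all_iff.2 h] with ω hω ε hε
  obtain ⟨m, hm⟩ := exists_nat_one_div_lt hε
  filter_upwards [hω m] with n hn p hp k hk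
  exact (hn p hp k hk).trans_le (by gcongr)

/-- The scaled counting functions of an equidistributed sequence converge to `x y`. -/
lemma IsEquidistributed.tendsto {σ : (n : ℕ) → Equiv.Perm (Fin n)} (hσ : IsEquidistributed σ)
    {p k : ℕ → ℕ} (hp : ∀ n, p n ≤ n) (hk : ∀ n, k n ≤ n) {x y : ℝ}
    (hx : Tendsto (fun n => (p n : ℝ) / n) atTop (𝓝 x))
    (hy : Tendsto (fun n => (k n : ℝ) / n) atTop (𝓝 y)) :
    Tendsto (fun n => (countBelow (σ n) (k n) (p n) : ℝ) / n) atTop (𝓝 (x * y)) := by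
  have h : Tendsto (fun n => (countBelow (σ n) (k n) (p n) : ℝ) / n - (p n : ℝ) / n * (k n / n))
      atTop (𝓝 0) := by
    rw [Metric.tendsto_atTop']
    intro ε hε
    obtain ⟨N, hN⟩ := eventually_atTop.1 ((hσ ε hε).and (eventually_gt_atTop 0))
    refine ⟨N, fun n hn => ?_⟩
    obtain ⟨h1, h2⟩ := hN n hn.le
    have hn' : (0 : ℝ) < n := by exact_mod_cast h2
    rw [Real.dist_eq, sub_zero, show (countBelow (σ n) (k n) (p n) : ℝ) / n - (p n : ℝ) / n * (k n / n)
      = ((countBelow (σ n) (k n) (p n) : ℝ) - p n * k n / n) / n by field_simp, abs_div,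
      abs_of_pos hn', div_lt_iff₀ hn']
    exact h1 _ (hp n) _ (hk n)
  simpa using h.add (hx.mul hy)

/-! ### Weak convergence from distribution functions -/

lemma measureReal_Ioc_prod_Ioc (μ : Measure (ℝ × ℝ)) [IsFiniteMeasure μ] {a b c d : ℝ}
    (hab : a ≤ b) (hcd : c ≤ d) :
    μ.real (Set.Ioc a b ×ˢ Set.Ioc c d) =
      μ.real (Set.Iic b ×ˢ Set.Iic d) - μ.real (Set.Iic a ×ˢ Set.Iic d) -
        (μ.real (Set.Iic b ×ˢ Set.Iic c) - μ.real (Set.Iic a ×ˢ Set.Iic c)) := by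
  have h1 : ∀ e : ℝ, μ.real (Set.Ioc a b ×ˢ Set.Iic e) =
      μ.real (Set.Iic b ×ˢ Set.Iic e) - μ.real (Set.Iic a ×ˢ Set.Iic e) := by
    intro e
    rw [← measureReal_sdiff (Set.prod_mono_left (Set.Iic_subset_Iic.2 hab))
      (measurableSet_Iic.prod measurableSet_Iic)]
    congr 1
    ext ⟨s, t⟩
    simp only [Set.mem_prod, Set.mem_Ioc, Set.mem_Iic, Set.mem_sdiff]
    constructor
    · rintro ⟨⟨h1, h2⟩, h3⟩
      exact ⟨⟨h2, h3⟩, fun h => absurd h.1 h1.not_ge⟩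
    · rintro ⟨⟨h2, h3⟩, h⟩
      exact ⟨⟨lt_of_not_ge fun h' => h ⟨h', h3⟩, h2⟩, h3⟩
  rw [← h1, ← h1, ← measureReal_sdiff (Set.prod_mono_right (Set.Iic_subset_Iic.2 hcd))
      (measurableSet_Ioc.prod measurableSet_Iic)]
  congr 1
  ext ⟨s, t⟩
  simp only [Set.mem_prod, Set.mem_Ioc, Set.mem_Iic, Set.mem_sdiff]
  constructor
  · rintro ⟨h3, ⟨h1, h2⟩⟩
    exact ⟨⟨h3, h2⟩, fun h => absurd h.2 h1.not_ge⟩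
  · rintro ⟨⟨h2, h3⟩, h⟩
    exact ⟨h2, lt_of_not_ge fun h' => h ⟨h2, h'⟩, h3⟩

/-- Pointwise convergence of bivariate distribution functions implies weak convergence. -/
lemma tendsto_probabilityMeasure_of_tendsto_cdf {μ : ℕ → ProbabilityMeasure (ℝ × ℝ)}
    {ν : ProbabilityMeasure (ℝ × ℝ)}
    (h : ∀ x y : ℝ, Tendsto (fun n => (μ n : Measure (ℝ × ℝ)).real (Set.Iic x ×ˢ Set.Iic y)) atTop
      (𝓝 ((ν : Measure (ℝ × ℝ)).real (Set.Iic x ×ˢ Set.Iic y)))) :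
    Tendsto μ atTop (𝓝 ν) := by
  have hpi := (isPiSystem_Ioc (id : ℝ → ℝ) id).prod (isPiSystem_Ioc (id : ℝ → ℝ) id)
  -- Half-open rectangles form a π-system containing arbitrarily small neighbourhoods of each point,
  -- and their masses are alternating sums of four values of the distribution function.
  refine hpi.tendsto_probabilityMeasure_of_tendsto_of_mem ?_ ?_ ?_
  · rintro s ⟨A, ⟨a, b, -, rfl⟩, B, ⟨c, d, -, rfl⟩, rfl⟩
    exact measurableSet_Ioc.prod measurableSet_Ioc
  · rintro U hU ⟨x, y⟩ hx
    obtain ⟨ε, hε, hball⟩ := Metric.nhds_basis_closedBall.mem_iff.1 (hU.mem_nhds hx)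
    refine ⟨_, ⟨_, ⟨x - ε, x + ε, by simp only [id]; linarith, rfl⟩, _,
      ⟨y - ε, y + ε, by simp only [id]; linarith, rfl⟩, rfl⟩, ?_, ?_⟩
    · exact prod_mem_nhds (Ioc_mem_nhds (by simp only [id]; linarith) (by simp only [id]; linarith))
        (Ioc_mem_nhds (by simp only [id]; linarith) (by simp only [id]; linarith))
    · refine Set.Subset.trans ?_ hball
      rw [← closedBall_prod_same, Real.closedBall_eq_Icc, Real.closedBall_eq_Icc]
      exact Set.prod_mono Set.Ioc_subset_Icc_self Set.Ioc_subset_Icc_self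
  · rintro s ⟨A, ⟨a, b, hab, rfl⟩, B, ⟨c, d, hcd, rfl⟩, rfl⟩
    rw [← NNReal.tendsto_coe]
    simp only [← ProbabilityMeasure.measureReal_eq_coe_coeFn, id] at hab hcd ⊢
    rw [measureReal_Ioc_prod_Ioc _ hab.le hcd.le]
    simp_rw [measureReal_Ioc_prod_Ioc _ hab.le hcd.le]
    exact ((h _ _).sub (h _ _)).sub ((h _ _).sub (h _ _))

/-- The unit square. -/
def unitSquare : Set (ℝ × ℝ) := Set.Icc (0 : ℝ) 1 ×ˢ Set.Icc (0 : ℝ) 1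

lemma measurableSet_unitSquare : MeasurableSet unitSquare :=
  measurableSet_Icc.prod measurableSet_Icc

lemma measureReal_Iic_eq_zero {μ : Measure (ℝ × ℝ)} (hμ : μ unitSquareᶜ = 0) {x y : ℝ}
    (h : x < 0 ∨ y < 0) : μ.real (Set.Iic x ×ˢ Set.Iic y) = 0 := by
  rw [measureReal_def, measure_mono_null _ hμ, ENNReal.toReal_zero]
  rintro ⟨s, t⟩ ⟨hs, ht⟩ ⟨h1, h2⟩
  simp only [Set.mem_Iic, Set.mem_Icc] at *
  rcases h with h | h <;> linarith

lemma measureReal_Iic_min_one {μ : Measure (ℝ × ℝ)} (hμ : μ unitSquareᶜ = 0) (x y : ℝ) :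
    μ.real (Set.Iic x ×ˢ Set.Iic y) = μ.real (Set.Iic (min x 1) ×ˢ Set.Iic (min y 1)) := by
  have hsq : ∀ᵐ p ∂μ, p ∈ unitSquare := hμ
  apply measureReal_congr
  filter_upwards [hsq] with p hp
  apply propext
  show (p.1 ≤ x ∧ p.2 ≤ y) ↔ (p.1 ≤ min x 1 ∧ p.2 ≤ min y 1)
  simp [hp.1.2, hp.2.2]

/-- For measures on the unit square, it suffices to control the distribution functions there. -/
lemma tendsto_probabilityMeasure_of_tendsto_cdf_unitSquare {μ : ℕ → ProbabilityMeasure (ℝ × ℝ)}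
    {ν : ProbabilityMeasure (ℝ × ℝ)} (hμ : ∀ n, (μ n : Measure (ℝ × ℝ)) unitSquareᶜ = 0)
    (hν : (ν : Measure (ℝ × ℝ)) unitSquareᶜ = 0)
    (h : ∀ x ∈ Set.Icc (0 : ℝ) 1, ∀ y ∈ Set.Icc (0 : ℝ) 1,
      Tendsto (fun n => (μ n : Measure (ℝ × ℝ)).real (Set.Iic x ×ˢ Set.Iic y)) atTop
      (𝓝 ((ν : Measure (ℝ × ℝ)).real (Set.Iic x ×ˢ Set.Iic y)))) :
    Tendsto μ atTop (𝓝 ν) := by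
  apply tendsto_probabilityMeasure_of_tendsto_cdf
  intro x y
  by_cases hxy : x < 0 ∨ y < 0
  · simp_rw [measureReal_Iic_eq_zero hν hxy, measureReal_Iic_eq_zero (hμ _) hxy]
    exact tendsto_const_nhds
  · push Not at hxy
    rw [measureReal_Iic_min_one hν]
    simp_rw [measureReal_Iic_min_one (hμ _) x y]
    exact h _ ⟨le_min hxy.1 zero_le_one, min_le_right _ _⟩ _
      ⟨le_min hxy.2 zero_le_one, min_le_right _ _⟩

/-! ### Distribution functions of the permutons of permutations -/

lemma plotSquare_eq {n : ℕ} (hn : 0 < n) (u : Equiv.Perm (Fin n)) (j : Fin n) :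
    plotSquare u j = Set.Icc ((j : ℝ) / n) (((j : ℝ) + 1) / n) ×ˢ
      Set.Icc (((u j : ℕ) : ℝ) / n) ((((u j : ℕ) : ℝ) + 1) / n) := by
  have hn' : (0 : ℝ) < n := by exact_mod_cast hn
  ext ⟨s, t⟩
  simp only [plotSquare, Set.mem_ofPred_eq, Set.mem_prod, Set.mem_Icc, div_le_iff₀ hn',
    le_div_iff₀ hn', mul_comm _ (n : ℝ), and_assoc]

lemma measurableSet_plotSquare {n : ℕ} (u : Equiv.Perm (Fin n)) (j : Fin n) :
    MeasurableSet (plotSquare u j) := by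
  rw [plotSquare_eq j.pos]
  exact measurableSet_Icc.prod measurableSet_Icc

lemma volume_plotSquare {n : ℕ} (u : Equiv.Perm (Fin n)) (j : Fin n) :
    (n : ℝ≥0∞) * volume (plotSquare u j) = ENNReal.ofReal (1 / n) := by
  have hn : (0 : ℝ) < n := by exact_mod_cast j.pos
  rw [plotSquare_eq j.pos, Measure.volume_eq_prod, Measure.prod_prod, Real.volume_Icc,
    Real.volume_Icc, ← ENNReal.ofReal_natCast, ← ENNReal.ofReal_mul (by field_simp; simp),
    ← ENNReal.ofReal_mul (by positivity)]
  congr 1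
  field_simp
  ring

lemma volume_vertical_line (c : ℝ) : volume {p : ℝ × ℝ | p.1 = c} = 0 := by
  have : {p : ℝ × ℝ | p.1 = c} = {c} ×ˢ Set.univ := by ext; simp
  rw [this, Measure.volume_eq_prod, Measure.prod_prod]
  simp

lemma volume_horizontal_line (c : ℝ) : volume {p : ℝ × ℝ | p.2 = c} = 0 := by
  have : {p : ℝ × ℝ | p.2 = c} = Set.univ ×ˢ {c} := by ext; simp
  rw [this, Measure.volume_eq_prod, Measure.prod_prod]
  simp

lemma aedisjoint_plotSquare {n : ℕ} (u : Equiv.Perm (Fin n)) :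
    Pairwise (Function.onFun (AEDisjoint volume) (plotSquare u)) := by
  have key : ∀ i j : Fin n, i < j → AEDisjoint volume (plotSquare u i) (plotSquare u j) := by
    intro i j hij
    refine measure_mono_null ?_ (volume_vertical_line ((j : ℝ) / n))
    rintro p ⟨hi, hj⟩
    have hn : (0 : ℝ) < n := by exact_mod_cast i.pos
    have h1 := hi.2.1
    have h2 := hj.1
    have h3 : ((i : ℕ) : ℝ) + 1 ≤ ((j : ℕ) : ℝ) := by exact_mod_cast hij
    show p.1 = _
    rw [eq_div_iff hn.ne']
    linarith
  intro i j hij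
  rcases lt_or_gt_of_ne hij with h | h
  · exact key i j h
  · exact (key j i h).symm

lemma permPermuton_apply {n : ℕ} (u : Equiv.Perm (Fin n)) {A : Set (ℝ × ℝ)}
    (hA : MeasurableSet A) :
    permPermuton u A = ∑ j : Fin n, (n : ℝ≥0∞) * volume (A ∩ plotSquare u j) := by
  rw [permPermuton, Measure.smul_apply, Measure.restrict_iUnion_apply_ae (aedisjoint_plotSquare u)
    (fun j => (measurableSet_plotSquare u j).nullMeasurableSet) hA, tsum_fintype, smul_eq_mul,
    Finset.mul_sum]
  exact Finset.sum_congr rfl (fun j _ => by rw [Measure.restrict_apply hA])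

lemma isProbabilityMeasure_permPermuton {n : ℕ} (hn : 0 < n) (u : Equiv.Perm (Fin n)) :
    IsProbabilityMeasure (permPermuton u) := by
  constructor
  rw [permPermuton_apply u MeasurableSet.univ]
  simp_rw [Set.univ_inter, volume_plotSquare]
  rw [Finset.sum_const, Finset.card_univ, Fintype.card_fin, nsmul_eq_mul,
    ← ENNReal.ofReal_natCast, ← ENNReal.ofReal_mul (by positivity), mul_one_div_cancel
    (by positivity), ENNReal.ofReal_one]

lemma isFiniteMeasure_permPermuton {n : ℕ} (u : Equiv.Perm (Fin n)) :
    IsFiniteMeasure (permPermuton u) := by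
  rcases Nat.eq_zero_or_pos n with rfl | hn
  · simp only [permPermuton, Nat.cast_zero, zero_smul]
    infer_instance
  · have := isProbabilityMeasure_permPermuton hn u
    infer_instance

lemma permPermuton_compl_unitSquare {n : ℕ} (u : Equiv.Perm (Fin n)) :
    permPermuton u unitSquareᶜ = 0 := by
  rw [permPermuton_apply u measurableSet_unitSquare.compl]
  refine Finset.sum_eq_zero (fun j _ => ?_)
  have hn : (0 : ℝ) < n := by exact_mod_cast j.pos
  have hj : ((j : ℕ) : ℝ) + 1 ≤ n := by exact_mod_cast j.2
  have huj : ((u j : ℕ) : ℝ) + 1 ≤ n := by exact_mod_cast (u j).2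
  have : unitSquareᶜ ∩ plotSquare u j = ∅ := by
    rw [Set.eq_empty_iff_forall_notMem]
    rintro p ⟨h, h1, h2, h3, h4⟩
    refine h ⟨⟨?_, ?_⟩, ?_, ?_⟩
    · exact nonneg_of_mul_nonneg_right (le_trans (Nat.cast_nonneg _) h1) hn
    · exact le_of_mul_le_mul_left (by linarith) hn
    · exact nonneg_of_mul_nonneg_right (le_trans (Nat.cast_nonneg _) h3) hn
    · exact le_of_mul_le_mul_left (by linarith) hn
  rw [this, measure_empty, mul_zero]

lemma ofReal_countBelow_div {n : ℕ} (u : Equiv.Perm (Fin n)) (k p : ℕ) :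
    ENNReal.ofReal ((countBelow u k p : ℝ) / n) =
      ∑ j : Fin n, if (j : ℕ) < p ∧ (u j : ℕ) < k then ENNReal.ofReal (1 / n) else 0 := by
  rw [← Finset.sum_filter, Finset.sum_const, nsmul_eq_mul, ← ENNReal.ofReal_natCast,
    ← ENNReal.ofReal_mul (by positivity), mul_one_div, countBelow]
  simp only [Nat.cast_lt]

/-- When the corner is rounded down, every counted square lies entirely in the quadrant. -/
lemma le_permPermuton_Iic {n : ℕ} (u : Equiv.Perm (Fin n)) {k p : ℕ} {x y : ℝ}
    (hp : (p : ℝ) ≤ n * x) (hk : (k : ℝ) ≤ n * y) :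
    ENNReal.ofReal ((countBelow u k p : ℝ) / n) ≤ permPermuton u (Set.Iic x ×ˢ Set.Iic y) := by
  rw [ofReal_countBelow_div, permPermuton_apply u (measurableSet_Iic.prod measurableSet_Iic)]
  refine Finset.sum_le_sum (fun j _ => ?_)
  split_ifs with h
  · rw [← volume_plotSquare u j, Set.inter_eq_self_of_subset_right]
    rintro q ⟨-, h1, -, h2⟩
    have hn : (0 : ℝ) < n := by exact_mod_cast j.pos
    have h3 : ((j : ℕ) : ℝ) + 1 ≤ p := by exact_mod_cast h.1
    have h4 : ((u j : ℕ) : ℝ) + 1 ≤ k := by exact_mod_cast h.2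
    exact ⟨le_of_mul_le_mul_left (by linarith) hn, le_of_mul_le_mul_left (by linarith) hn⟩
  · exact zero_le

/-- When the corner is rounded up, an uncounted square meets the quadrant at most in a line segment,
which is null. -/
lemma permPermuton_Iic_le {n : ℕ} (u : Equiv.Perm (Fin n)) {k p : ℕ} {x y : ℝ}
    (hp : n * x ≤ p) (hk : n * y ≤ k) :
    permPermuton u (Set.Iic x ×ˢ Set.Iic y) ≤ ENNReal.ofReal ((countBelow u k p : ℝ) / n) := by
  rw [ofReal_countBelow_div, permPermuton_apply u (measurableSet_Iic.prod measurableSet_Iic)]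
  refine Finset.sum_le_sum (fun j _ => ?_)
  have hn : (0 : ℝ) < n := by exact_mod_cast j.pos
  split_ifs with h
  · rw [← volume_plotSquare u j]
    exact mul_le_mul_right (measure_mono Set.inter_subset_right) _
  · rw [nonpos_iff_eq_zero]
    rw [not_and_or, not_lt, not_lt] at h
    rcases h with h | h
    · rw [measure_mono_null _ (volume_vertical_line x), mul_zero]
      rintro q ⟨hq, h1, -, -, -⟩
      have h3 : (p : ℝ) ≤ ((j : ℕ) : ℝ) := by exact_mod_cast h
      exact le_antisymm hq.1 (le_of_mul_le_mul_left (by linarith) hn)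
    · rw [measure_mono_null _ (volume_horizontal_line y), mul_zero]
      rintro q ⟨hq, -, -, h1, -⟩
      have h3 : (k : ℝ) ≤ ((u j : ℕ) : ℝ) := by exact_mod_cast h
      exact le_antisymm hq.2 (le_of_mul_le_mul_left (by linarith) hn)

/-- If the scaled counting functions of `u n` converge, so do the distribution functions of the
permutons of `u n`. -/
lemma tendsto_permPermuton_real_Iic {u : (n : ℕ) → Equiv.Perm (Fin n)} {x y c : ℝ}
    (hx : x ∈ Set.Icc (0 : ℝ) 1) (hy : y ∈ Set.Icc (0 : ℝ) 1)
    (h : ∀ p k : ℕ → ℕ, (∀ n, p n ≤ n) → (∀ n, k n ≤ n) →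
      Tendsto (fun n => (p n : ℝ) / n) atTop (𝓝 x) →
      Tendsto (fun n => (k n : ℝ) / n) atTop (𝓝 y) →
      Tendsto (fun n => (countBelow (u n) (k n) (p n) : ℝ) / n) atTop (𝓝 c)) :
    Tendsto (fun n => (permPermuton (u n)).real (Set.Iic x ×ˢ Set.Iic y)) atTop (𝓝 c) := by
  have hfloor : ∀ z ∈ Set.Icc (0 : ℝ) 1, (∀ n : ℕ, ⌊z * n⌋₊ ≤ n) ∧
      Tendsto (fun n : ℕ => (⌊z * n⌋₊ : ℝ) / n) atTop (𝓝 z) := by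
    intro z hz
    refine ⟨fun n => ?_, (tendsto_nat_floor_mul_div_atTop hz.1).comp tendsto_natCast_atTop_atTop⟩
    exact Nat.floor_le_of_le (mul_le_of_le_one_left n.cast_nonneg hz.2)
  have hceil : ∀ z ∈ Set.Icc (0 : ℝ) 1, (∀ n : ℕ, ⌈z * n⌉₊ ≤ n) ∧
      Tendsto (fun n : ℕ => (⌈z * n⌉₊ : ℝ) / n) atTop (𝓝 z) := by
    intro z hz
    refine ⟨fun n => ?_, (tendsto_nat_ceil_mul_div_atTop hz.1).comp tendsto_natCast_atTop_atTop⟩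
    exact Nat.ceil_le.2 (mul_le_of_le_one_left n.cast_nonneg hz.2)
  have h1 := h _ _ (hfloor x hx).1 (hfloor y hy).1 (hfloor x hx).2 (hfloor y hy).2
  have h2 := h _ _ (hceil x hx).1 (hceil y hy).1 (hceil x hx).2 (hceil y hy).2
  refine tendsto_of_tendsto_of_tendsto_of_le_of_le h1 h2 (fun n => ?_) (fun n => ?_)
  · have := isFiniteMeasure_permPermuton (u n)
    have hle := le_permPermuton_Iic (u n) (p := ⌊x * n⌋₊) (k := ⌊y * n⌋₊) (x := x) (y := y)
      (by rw [mul_comm (n : ℝ)]; exact Nat.floor_le (mul_nonneg hx.1 n.cast_nonneg))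
      (by rw [mul_comm (n : ℝ)]; exact Nat.floor_le (mul_nonneg hy.1 n.cast_nonneg))
    exact (ENNReal.ofReal_le_iff_le_toReal (measure_ne_top _ _)).1 hle
  · exact ENNReal.toReal_le_of_le_ofReal (by positivity)
      (permPermuton_Iic_le (u n) (by rw [mul_comm]; exact Nat.le_ceil _)
        (by rw [mul_comm]; exact Nat.le_ceil _))

/-! ### Disintegration of `nu` over vertical lines -/

lemma graphMeasure_congr {I J : Set ℝ} (h : I =ᵐ[volume] J) (f g : ℝ → ℝ) :
    graphMeasure I f g = graphMeasure J f g := by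
  rw [graphMeasure, graphMeasure, Measure.restrict_congr_set h]

lemma graphMeasure_apply {I : Set ℝ} {f g : ℝ → ℝ} (hg : Measurable g)
    {A : Set (ℝ × ℝ)} (hA : MeasurableSet A) :
    graphMeasure I f g A =
      ∫⁻ s in I, A.indicator (fun p => ENNReal.ofReal (f p.1)) (s, g s) := by
  have hm : Measurable (fun s : ℝ => (s, g s)) := measurable_id.prodMk hg
  rw [graphMeasure, Measure.map_apply hm hA, withDensity_apply _ (hm hA),
    ← lintegral_indicator (hm hA)]
  rfl

lemma volume_restrict_between_apply {I : Set ℝ} (hI : MeasurableSet I) {lo hi : ℝ → ℝ}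
    (hlo : Measurable lo) (hhi : Measurable hi) {A : Set (ℝ × ℝ)} (hA : MeasurableSet A) :
    volume.restrict {p : ℝ × ℝ | p.1 ∈ I ∧ lo p.1 ≤ p.2 ∧ p.2 ≤ hi p.1} A =
      ∫⁻ s in I, volume {t | (s, t) ∈ A ∧ lo s ≤ t ∧ t ≤ hi s} := by
  have hR : MeasurableSet {p : ℝ × ℝ | p.1 ∈ I ∧ lo p.1 ≤ p.2 ∧ p.2 ≤ hi p.1} :=
    (measurable_fst hI).inter ((measurableSet_le (hlo.comp measurable_fst) measurable_snd).inter
      (measurableSet_le measurable_snd (hhi.comp measurable_fst)))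
  rw [Measure.restrict_apply hA, Measure.volume_eq_prod, Measure.prod_apply (hA.inter hR),
    ← lintegral_indicator hI]
  refine lintegral_congr (fun s => ?_)
  by_cases hs : s ∈ I
  · rw [Set.indicator_of_mem hs]
    congr 1
    ext t
    simp [hs]
  · rw [Set.indicator_of_notMem hs]
    convert! measure_empty (μ := (volume : Measure ℝ))
    ext t
    simp [hs]

section Quotients

variable {β s : ℝ}

lemma quot_SE_of_lt (h : β < 1) : quot (β * (1 - β)) (1 - β) = (β : EReal) := by
  have : 1 - β ≠ 0 := by linarith
  rw [quot, if_neg this, mul_div_cancel_right₀ _ this]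

lemma quot_NW_of_pos (h : 0 < β) : quot (β * (1 - β)) β = ((1 - β : ℝ) : EReal) := by
  rw [quot, if_neg h.ne', mul_div_cancel_left₀ _ h.ne']

lemma one_sub_coe (r : ℝ) : (1 : EReal) - (r : EReal) = ((1 - r : ℝ) : EReal) := by
  rw [EReal.coe_sub, EReal.coe_one]

lemma one_sub_quot_NW_of_pos (h : 0 < β) : 1 - quot (β * (1 - β)) β = (β : EReal) := by
  rw [quot_NW_of_pos h, one_sub_coe, sub_sub_cancel]

/-- For `α = β(1-β)` both thresholds `α/(1-β)` and `1 - α/β` equal `β`, except where the convention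
gives an infinite value. There the strict bound on `s` makes the same criterion true, so `β = 0` and
`β = 1` need no separate treatment later. -/
lemma quot_SE_le_iff (hβ : β ≤ 1) (h1 : s < 1) :
    quot (β * (1 - β)) (1 - β) ≤ (s : EReal) ↔ β ≤ s := by
  rcases hβ.lt_or_eq with h | rfl
  · rw [quot_SE_of_lt h, EReal.coe_le_coe_iff]
  · simp [quot, h1]

lemma le_quot_SE_iff (hβ : β ≤ 1) (h1 : s < 1) :
    (s : EReal) ≤ quot (β * (1 - β)) (1 - β) ↔ s ≤ β := by
  rcases hβ.lt_or_eq with h | rfl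
  · rw [quot_SE_of_lt h, EReal.coe_le_coe_iff]
  · simp [quot, h1.le]

lemma le_one_sub_quot_NW_iff (hβ : 0 ≤ β) (h0 : 0 < s) :
    (s : EReal) ≤ 1 - quot (β * (1 - β)) β ↔ s ≤ β := by
  rcases hβ.lt_or_eq with h | rfl
  · rw [one_sub_quot_NW_of_pos h, EReal.coe_le_coe_iff]
  · simp [quot, h0, EReal.sub_top]

lemma one_sub_quot_NW_le_iff (hβ : 0 ≤ β) (h0 : 0 < s) :
    1 - quot (β * (1 - β)) β ≤ (s : EReal) ↔ β ≤ s := by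
  rcases hβ.lt_or_eq with h | rfl
  · rw [one_sub_quot_NW_of_pos h, EReal.coe_le_coe_iff]
  · simp [quot, h0.le, EReal.sub_top]

lemma curveSE_eq (h : β < 1) : curveSE (β * (1 - β)) β s = 1 - β / (1 - s + β) := by
  have : 1 - β ≠ 0 := by linarith
  rw [curveSE, show (1 - β) * (1 - s) + β * (1 - β) = (1 - s + β) * (1 - β) by ring,
    mul_div_mul_right _ _ this]

lemma curveNW_eq (h : 0 < β) : curveNW (β * (1 - β)) β s = (1 - β) / (s + 1 - β) := by
  rw [curveNW, show β * s + β * (1 - β) = β * (s + 1 - β) by ring,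
    mul_div_mul_left _ _ h.ne']

lemma curveSE_le_iff {y : ℝ} (hβ : β ∈ Set.Icc (0 : ℝ) 1) (hs : β ≤ s) (h1 : s < 1) :
    curveSE (β * (1 - β)) β s ≤ y ↔ (1 - y) * (1 - s + β) ≤ β := by
  have hd : 0 < 1 - s + β := by linarith [hβ.1]
  rw [curveSE_eq (by linarith), sub_le_comm, le_div_iff₀ hd]

lemma curveNW_le_iff {y : ℝ} (hβ : β ∈ Set.Icc (0 : ℝ) 1) (h0 : 0 < s) (hs : s ≤ β) :
    curveNW (β * (1 - β)) β s ≤ y ↔ 1 - β ≤ y * (s + 1 - β) := by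
  have hd : 0 < s + 1 - β := by linarith [hβ.2]
  rw [curveNW_eq (by linarith), div_le_iff₀ hd]

/-- This curve descends from `(β, 1-β)` to height `0` or above, so the cut-off at height `1-β` in
`regionSE` is automatic. -/
lemma curveSE_mem (hβ : β ∈ Set.Icc (0 : ℝ) 1) (hs : β ≤ s) (h1 : s < 1) :
    0 ≤ curveSE (β * (1 - β)) β s ∧ curveSE (β * (1 - β)) β s ≤ 1 - β := by
  have hd : 0 < 1 - s + β := by linarith [hβ.1]
  constructor
  · rw [curveSE_eq (by linarith), sub_nonneg, div_le_one hd]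
    linarith
  · rw [curveSE_le_iff hβ hs h1]
    nlinarith [hβ.1]

lemma curveNW_mem (hβ : β ∈ Set.Icc (0 : ℝ) 1) (h0 : 0 < s) (hs : s ≤ β) :
    1 - β ≤ curveNW (β * (1 - β)) β s ∧ curveNW (β * (1 - β)) β s ≤ 1 := by
  have hd : 0 < s + 1 - β := by linarith [hβ.2]
  constructor
  · rw [curveNW_eq (by linarith), le_div_iff₀ hd]
    nlinarith [hβ.2]
  · rw [curveNW_le_iff hβ h0 hs]
    linarith

lemma mem_regionSE_iff (hβ : β ∈ Set.Icc (0 : ℝ) 1) (h0 : 0 < s) (h1 : s < 1) {t : ℝ} :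
    (s, t) ∈ regionSE (β * (1 - β)) β ↔
      β ≤ s ∧ 0 ≤ t ∧ t ≤ curveSE (β * (1 - β)) β s := by
  simp only [regionSE, Set.mem_ofPred_eq, quot_SE_le_iff hβ.2 h1]
  constructor
  · rintro ⟨-, ht, hs, -, hc⟩
    exact ⟨hs, ht.1, hc⟩
  · rintro ⟨hs, ht, hc⟩
    have hm := (curveSE_mem hβ hs h1).2
    refine ⟨⟨h0.le, h1.le⟩, ⟨ht, by linarith [hβ.1]⟩, hs, ?_, hc⟩
    rw [quot_SE_of_lt (by linarith), one_sub_coe, min_self, EReal.coe_le_coe_iff]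
    linarith

lemma mem_regionNW_iff (hβ : β ∈ Set.Icc (0 : ℝ) 1) (h0 : 0 < s) (h1 : s < 1) {t : ℝ} :
    (s, t) ∈ regionNW (β * (1 - β)) β ↔
      s ≤ β ∧ curveNW (β * (1 - β)) β s ≤ t ∧ t ≤ 1 := by
  simp only [regionNW, Set.mem_ofPred_eq, le_one_sub_quot_NW_iff hβ.1 h0]
  constructor
  · rintro ⟨-, ht, hs, -, hc⟩
    exact ⟨hs, hc, ht.2⟩
  · rintro ⟨hs, hc, ht⟩
    have hm := (curveNW_mem hβ h0 hs).1
    refine ⟨⟨h0.le, h1.le⟩, ⟨by linarith [hβ.2], ht⟩, hs, ?_, hc⟩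
    rw [quot_NW_of_pos (by linarith), max_self, EReal.coe_le_coe_iff]
    linarith

end Quotients

lemma measurable_curveSE (α β : ℝ) : Measurable (curveSE α β) := by
  unfold curveSE; fun_prop

lemma measurable_curveNW (α β : ℝ) : Measurable (curveNW α β) := by
  unfold curveNW; fun_prop

/-- The part of `ν` on the right of the line `x = β`. -/
noncomputable def nuSE (β : ℝ) : Measure (ℝ × ℝ) :=
  -- The constant bound is kept as a function of `p.1` to match `volume_restrict_between_apply`.
  volume.restrict {p : ℝ × ℝ | p.1 ∈ Set.Ioo β 1 ∧ (fun _ => 0) p.1 ≤ p.2 ∧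
    p.2 ≤ curveSE (β * (1 - β)) β p.1} +
  graphMeasure (Set.Ioo β 1) (fun s => 1 - curveSE (β * (1 - β)) β s) (curveSE (β * (1 - β)) β)

/-- The part of `ν` on the left of the line `x = β`. -/
noncomputable def nuNW (β : ℝ) : Measure (ℝ × ℝ) :=
  volume.restrict {p : ℝ × ℝ | p.1 ∈ Set.Ioo 0 β ∧ curveNW (β * (1 - β)) β p.1 ≤ p.2 ∧
    p.2 ≤ (fun _ => 1) p.1} +
  graphMeasure (Set.Ioo 0 β) (curveNW (β * (1 - β)) β) (curveNW (β * (1 - β)) β)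

lemma ae_ne (c : ℝ) : ∀ᵐ s : ℝ ∂volume, s ≠ c := by
  simp [ae_iff]

lemma ae_fst_ne (c : ℝ) : ∀ᵐ p : ℝ × ℝ ∂volume, p.1 ≠ c := by
  simpa [ae_iff] using volume_vertical_line c

/-- Discarding the null lines `x = 0`, `x = β`, `x = 1` avoids all degenerate quotients. The
antidiagonal lives only over `x = β` and disappears. -/
lemma nu_eq {β : ℝ} (hβ : β ∈ Set.Icc (0 : ℝ) 1) :
    nu (β * (1 - β)) β = nuSE β + nuNW β := by
  have hSE : rangeSE (β * (1 - β)) β =ᵐ[volume] Set.Ioo β 1 := by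
    filter_upwards [ae_ne 0, ae_ne β, ae_ne 1] with s h0 hb h1
    apply propext
    show s ∈ rangeSE _ _ ↔ s ∈ Set.Ioo β 1
    constructor
    · rintro ⟨⟨g0, g1⟩, g⟩
      rw [max_le_iff, quot_SE_le_iff hβ.2 (lt_of_le_of_ne g1 h1)] at g
      exact ⟨lt_of_le_of_ne g.1 hb.symm, lt_of_le_of_ne g1 h1⟩
    · rintro ⟨g0, g1⟩
      have : 0 < s := hβ.1.trans_lt g0
      refine ⟨⟨this.le, g1.le⟩, ?_⟩
      rw [max_le_iff, quot_SE_le_iff hβ.2 g1, one_sub_quot_NW_le_iff hβ.1 this]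
      exact ⟨g0.le, g0.le⟩
  have hNW : rangeNW (β * (1 - β)) β =ᵐ[volume] Set.Ioo 0 β := by
    filter_upwards [ae_ne 0, ae_ne β, ae_ne 1] with s h0 hb h1
    apply propext
    show s ∈ rangeNW _ _ ↔ s ∈ Set.Ioo 0 β
    constructor
    · rintro ⟨⟨g0, g1⟩, g⟩
      have h0' := lt_of_le_of_ne g0 h0.symm
      rw [le_min_iff, le_one_sub_quot_NW_iff hβ.1 h0'] at g
      exact ⟨h0', lt_of_le_of_ne g.2 hb⟩
    · rintro ⟨g0, g1⟩
      have : s < 1 := g1.trans_le hβ.2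
      refine ⟨⟨g0.le, this.le⟩, ?_⟩
      rw [le_min_iff, le_quot_SE_iff hβ.2 this, le_one_sub_quot_NW_iff hβ.1 g0]
      exact ⟨g1.le, g1.le⟩
  have hD : rangeDiag (β * (1 - β)) β =ᵐ[volume] (∅ : Set ℝ) := by
    filter_upwards [ae_ne 0, ae_ne β, ae_ne 1] with s h0 hb h1
    apply propext
    show s ∈ rangeDiag _ _ ↔ s ∈ (∅ : Set ℝ)
    simp only [Set.mem_empty_iff_false, iff_false]
    rintro ⟨⟨g0, g1⟩, g, g'⟩
    rw [one_sub_quot_NW_le_iff hβ.1 (lt_of_le_of_ne g0 h0.symm)] at g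
    rw [le_quot_SE_iff hβ.2 (lt_of_le_of_ne g1 h1)] at g'
    exact hb (le_antisymm g' g)
  have hreg : (regionSE (β * (1 - β)) β ∪ regionNW (β * (1 - β)) β : Set (ℝ × ℝ)) =ᵐ[volume]
      ({p : ℝ × ℝ | p.1 ∈ Set.Ioo β 1 ∧ (fun _ => 0) p.1 ≤ p.2 ∧
        p.2 ≤ curveSE (β * (1 - β)) β p.1} ∪
      {p : ℝ × ℝ | p.1 ∈ Set.Ioo 0 β ∧ curveNW (β * (1 - β)) β p.1 ≤ p.2 ∧
        p.2 ≤ (fun _ => 1) p.1} : Set (ℝ × ℝ)) := by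
    filter_upwards [ae_fst_ne 0, ae_fst_ne β, ae_fst_ne 1] with ⟨s, t⟩ h0 hb h1
    apply propext
    show (_ ∨ _) ↔ (_ ∨ _)
    simp only [] at h0 hb h1
    by_cases hs : 0 < s ∧ s < 1
    · refine or_congr ((mem_regionSE_iff hβ hs.1 hs.2).trans ?_)
        ((mem_regionNW_iff hβ hs.1 hs.2).trans ?_)
      · refine and_congr ?_ Iff.rfl
        exact ⟨fun h => ⟨lt_of_le_of_ne h hb.symm, hs.2⟩, fun h => h.1.le⟩
      · refine and_congr ?_ Iff.rfl
        exact ⟨fun h => ⟨hs.1, lt_of_le_of_ne h hb⟩, fun h => h.2.le⟩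
    · constructor
      · rintro (h | h)
        · exact absurd ⟨lt_of_le_of_ne h.1.1 h0.symm, lt_of_le_of_ne h.1.2 h1⟩ hs
        · exact absurd ⟨lt_of_le_of_ne h.1.1 h0.symm, lt_of_le_of_ne h.1.2 h1⟩ hs
      · rintro (h | h)
        · exact absurd ⟨hβ.1.trans_lt h.1.1, h.1.2⟩ hs
        · exact absurd ⟨h.1.1, h.1.2.trans_le hβ.2⟩ hs
  have hdisj : Disjoint {p : ℝ × ℝ | p.1 ∈ Set.Ioo β 1 ∧ (fun _ => 0) p.1 ≤ p.2 ∧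
        p.2 ≤ curveSE (β * (1 - β)) β p.1}
      {p : ℝ × ℝ | p.1 ∈ Set.Ioo 0 β ∧ curveNW (β * (1 - β)) β p.1 ≤ p.2 ∧
        p.2 ≤ (fun _ => 1) p.1} := by
    rw [Set.disjoint_left]
    rintro p ⟨h, -⟩ ⟨h', -⟩
    exact absurd h.1 h'.2.not_gt
  have hmeas : MeasurableSet {p : ℝ × ℝ | p.1 ∈ Set.Ioo 0 β ∧
      curveNW (β * (1 - β)) β p.1 ≤ p.2 ∧ p.2 ≤ (fun _ => 1) p.1} :=
    (measurable_fst measurableSet_Ioo).inter ((measurableSet_le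
      ((measurable_curveNW _ _).comp measurable_fst) measurable_snd).inter
      (measurableSet_le measurable_snd measurable_const))
  have hzero : graphMeasure (∅ : Set ℝ) (fun _ => 1) (fun x => 1 - x) = 0 := by
    simp [graphMeasure]
  have hw : (fun x => β * (1 - β) / ((1 - β) * (1 - x) + β * (1 - β))) =
      fun s => 1 - curveSE (β * (1 - β)) β s := by
    ext s
    rw [curveSE, sub_sub_cancel]
  rw [nu, Measure.restrict_congr_set hreg, Measure.restrict_union hdisj hmeas,
    graphMeasure_congr hSE, graphMeasure_congr hNW, graphMeasure_congr hD, hzero, add_zero, hw,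
    nuSE, nuNW]
  rw [add_assoc, add_assoc, add_assoc]
  congr 1
  rw [add_left_comm]
  rfl

lemma nuSE_apply (β : ℝ) {A : Set (ℝ × ℝ)} (hA : MeasurableSet A) :
    nuSE β A = ∫⁻ s in Set.Ioo β 1,
      (volume {t | (s, t) ∈ A ∧ 0 ≤ t ∧ t ≤ curveSE (β * (1 - β)) β s} +
        A.indicator (fun p => ENNReal.ofReal (1 - curveSE (β * (1 - β)) β p.1))
          (s, curveSE (β * (1 - β)) β s)) := by
  have hm := measurable_curveSE (β * (1 - β)) β
  rw [nuSE, Measure.add_apply,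
    volume_restrict_between_apply measurableSet_Ioo measurable_const hm hA,
    graphMeasure_apply hm hA, lintegral_add_right]
  exact (((measurable_const.sub hm).ennreal_ofReal.comp measurable_fst).indicator hA).comp
    (measurable_id.prodMk hm)

lemma nuNW_apply (β : ℝ) {A : Set (ℝ × ℝ)} (hA : MeasurableSet A) :
    nuNW β A = ∫⁻ s in Set.Ioo 0 β,
      (volume {t | (s, t) ∈ A ∧ curveNW (β * (1 - β)) β s ≤ t ∧ t ≤ 1} +
        A.indicator (fun p => ENNReal.ofReal (curveNW (β * (1 - β)) β p.1))
          (s, curveNW (β * (1 - β)) β s)) := by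
  have hm := measurable_curveNW (β * (1 - β)) β
  rw [nuNW, Measure.add_apply,
    volume_restrict_between_apply measurableSet_Ioo hm measurable_const hA,
    graphMeasure_apply hm hA, lintegral_add_right]
  exact ((hm.ennreal_ofReal.comp measurable_fst).indicator hA).comp (measurable_id.prodMk hm)

lemma nuSE_compl_unitSquare {β : ℝ} (hβ : β ∈ Set.Icc (0 : ℝ) 1) : nuSE β unitSquareᶜ = 0 := by
  classical
  rw [nuSE_apply β measurableSet_unitSquare.compl]
  refine (setLIntegral_congr_fun measurableSet_Ioo (g := fun _ => 0) (fun s hs => ?_)).trans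
    (by simp)
  have hc := curveSE_mem hβ hs.1.le hs.2
  have hsm : s ∈ Set.Icc (0 : ℝ) 1 := ⟨hβ.1.trans hs.1.le, hs.2.le⟩
  have h1 : {t | (s, t) ∈ unitSquareᶜ ∧ 0 ≤ t ∧ t ≤ curveSE (β * (1 - β)) β s} = ∅ := by
    rw [Set.eq_empty_iff_forall_notMem]
    rintro t ⟨h, h0, h1⟩
    exact h ⟨hsm, h0, by linarith [hβ.1]⟩
  have h2 : (s, curveSE (β * (1 - β)) β s) ∉ unitSquareᶜ :=
    fun h => h ⟨hsm, hc.1, by linarith [hβ.1]⟩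
  simp only [h1, Set.indicator_of_notMem h2, measure_empty, add_zero]

lemma nuNW_compl_unitSquare {β : ℝ} (hβ : β ∈ Set.Icc (0 : ℝ) 1) : nuNW β unitSquareᶜ = 0 := by
  classical
  rw [nuNW_apply β measurableSet_unitSquare.compl]
  refine (setLIntegral_congr_fun measurableSet_Ioo (g := fun _ => 0) (fun s hs => ?_)).trans
    (by simp)
  have hc := curveNW_mem hβ hs.1 hs.2.le
  have hsm : s ∈ Set.Icc (0 : ℝ) 1 := ⟨hs.1.le, hs.2.le.trans hβ.2⟩
  have h1 : {t | (s, t) ∈ unitSquareᶜ ∧ curveNW (β * (1 - β)) β s ≤ t ∧ t ≤ 1} = ∅ := by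
    rw [Set.eq_empty_iff_forall_notMem]
    rintro t ⟨h, h0, h1⟩
    exact h ⟨hsm, by linarith [hβ.2], h1⟩
  have h2 : (s, curveNW (β * (1 - β)) β s) ∉ unitSquareᶜ :=
    fun h => h ⟨hsm, by linarith [hβ.2], hc.2⟩
  simp only [h1, Set.indicator_of_notMem h2, measure_empty, add_zero]

/-! ### The distribution function of `nu` -/

lemma volume_eq_of_Ioo_subset_of_subset_Icc {S : Set ℝ} {a b : ℝ} (h1 : Set.Ioo a b ⊆ S)
    (h2 : S ⊆ Set.Icc a b) : volume S = ENNReal.ofReal (b - a) :=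
  le_antisymm ((measure_mono h2).trans_eq Real.volume_Icc)
    (Real.volume_Ioo.symm.trans_le (measure_mono h1))

/-- The fibre over `s` is Lebesgue measure on `[0, c]` plus an atom of mass `1 - c` at `c = curveSE
_ _ s`. Its mass up to height `y` is `y`, plus `1 - y` once `c ≤ y`. That last condition is linear
in `s`, so only interval lengths remain; `y = 1` is separate because of a division by `1 - y`. -/
lemma nuSE_Iic {β x y : ℝ} (hβ : β ∈ Set.Icc (0 : ℝ) 1) (hx : x ∈ Set.Icc (0 : ℝ) 1)
    (hy : y ∈ Set.Icc (0 : ℝ) 1) :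
    nuSE β (Set.Iic x ×ˢ Set.Iic y) = ENNReal.ofReal (y * max (x - β) 0 +
      max ((1 - y) * x - max ((1 - y) * β) ((1 - y) * (1 + β) - β)) 0) := by
  classical
  have hm := measurable_curveSE (β * (1 - β)) β
  rw [nuSE_apply β (measurableSet_Iic.prod measurableSet_Iic)]
  have hm1 : MeasurableSet {s | s ≤ x} := measurableSet_Iic
  have hm2 : MeasurableSet {s | s ≤ x ∧ curveSE (β * (1 - β)) β s ≤ y} :=
    measurableSet_Iic.inter (measurableSet_le hm measurable_const)
  have hfib : ∀ s ∈ Set.Ioo β 1,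
      (volume {t | (s, t) ∈ Set.Iic x ×ˢ Set.Iic y ∧ 0 ≤ t ∧ t ≤ curveSE (β * (1 - β)) β s} +
        (Set.Iic x ×ˢ Set.Iic y).indicator
          (fun p => ENNReal.ofReal (1 - curveSE (β * (1 - β)) β p.1))
          (s, curveSE (β * (1 - β)) β s)) =
      {s | s ≤ x}.indicator (fun _ => ENNReal.ofReal y) s +
        {s | s ≤ x ∧ curveSE (β * (1 - β)) β s ≤ y}.indicator
          (fun _ => ENNReal.ofReal (1 - y)) s := by
    intro s hs
    have hc := curveSE_mem hβ hs.1.le hs.2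
    simp only [Set.mem_prod, Set.mem_Iic, Set.indicator_apply, Set.mem_ofPred_eq]
    by_cases hsx : s ≤ x
    · by_cases hcy : curveSE (β * (1 - β)) β s ≤ y
      · have : {t | (s ≤ x ∧ t ≤ y) ∧ 0 ≤ t ∧ t ≤ curveSE (β * (1 - β)) β s} =
            Set.Icc 0 (curveSE (β * (1 - β)) β s) := by
          ext t
          simp only [Set.mem_ofPred_eq, Set.mem_Icc]
          exact ⟨fun h => h.2, fun h => ⟨⟨hsx, h.2.trans hcy⟩, h⟩⟩
        rw [this, Real.volume_Icc, if_pos ⟨hsx, hcy⟩, if_pos hsx, if_pos ⟨hsx, hcy⟩,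
          ← ENNReal.ofReal_add (by linarith) (by linarith [hβ.1]),
          ← ENNReal.ofReal_add hy.1 (by linarith [hy.2])]
        congr 1
        ring
      · have : {t | (s ≤ x ∧ t ≤ y) ∧ 0 ≤ t ∧ t ≤ curveSE (β * (1 - β)) β s} =
            Set.Icc 0 y := by
          ext t
          simp only [Set.mem_ofPred_eq, Set.mem_Icc]
          exact ⟨fun h => ⟨h.2.1, h.1.2⟩, fun h => ⟨⟨hsx, h.2⟩, h.1, h.2.trans (not_le.1 hcy).le⟩⟩
        rw [this, Real.volume_Icc, if_neg (fun h => hcy h.2), if_pos hsx,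
          if_neg (fun h => hcy h.2), sub_zero]
    · simp [hsx]
  rw [setLIntegral_congr_fun measurableSet_Ioo hfib, lintegral_add_left (measurable_const.indicator hm1),
    lintegral_indicator_const hm1, lintegral_indicator_const hm2, Measure.restrict_apply hm1,
    Measure.restrict_apply hm2, ENNReal.ofReal_add (mul_nonneg hy.1 (le_max_right _ _))
      (le_max_right _ _)]
  congr 1
  · rw [volume_eq_of_Ioo_subset_of_subset_Icc (a := β) (b := x), ENNReal.ofReal_mul hy.1,
      ENNReal.ofReal_max, ENNReal.ofReal_zero, max_eq_left (zero_le)]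
    · exact fun s hs => ⟨hs.2.le, hs.1, hs.2.trans_le hx.2⟩
    · exact fun s hs => ⟨hs.2.1.le, hs.1⟩
  · rcases hy.2.lt_or_eq with hy1 | rfl
    · have hy' : 0 < 1 - y := by linarith
      have hiff : ∀ s, (1 - y) * (1 - s + β) ≤ β ↔ ((1 - y) * (1 + β) - β) / (1 - y) ≤ s := by
        intro s
        rw [div_le_iff₀ hy']
        constructor <;> intro h <;> linarith
      rw [volume_eq_of_Ioo_subset_of_subset_Icc
        (a := max β (((1 - y) * (1 + β) - β) / (1 - y))) (b := x), ← ENNReal.ofReal_mul hy'.le,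
        ENNReal.ofReal_max, ENNReal.ofReal_zero, max_eq_left (zero_le)]
      · congr 1
        rw [mul_sub, mul_max_of_nonneg _ _ hy'.le, mul_div_cancel₀ _ hy'.ne']
      · rintro s ⟨hs1, hs2⟩
        rw [max_lt_iff] at hs1
        have hs3 := hs2.trans_le hx.2
        exact ⟨⟨hs2.le, (curveSE_le_iff hβ hs1.1.le hs3).2 ((hiff s).2 hs1.2.le)⟩, hs1.1, hs3⟩
      · rintro s ⟨⟨h1, h2⟩, h3, h4⟩
        exact ⟨max_le h3.le ((hiff s).1 ((curveSE_le_iff hβ h3.le h4).1 h2)), h1⟩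
    · simp [hβ.1]

/-- Here the atom of mass `c` sits at the bottom `c` of the fibre, so the mass up to height `y` is
`0` before the curve and exactly `y` after it. Negative arguments of `ENNReal.ofReal` cover the case
of an empty interval. -/
lemma nuNW_Iic {β x y : ℝ} (hβ : β ∈ Set.Icc (0 : ℝ) 1) (hy : y ∈ Set.Icc (0 : ℝ) 1) :
    nuNW β (Set.Iic x ×ˢ Set.Iic y) =
      ENNReal.ofReal (y * min x β - (1 - β) * (1 - y)) := by
  classical
  have hm := measurable_curveNW (β * (1 - β)) β
  rw [nuNW_apply β (measurableSet_Iic.prod measurableSet_Iic)]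
  have hm2 : MeasurableSet {s | s ≤ x ∧ curveNW (β * (1 - β)) β s ≤ y} :=
    measurableSet_Iic.inter (measurableSet_le hm measurable_const)
  have hfib : ∀ s ∈ Set.Ioo 0 β,
      (volume {t | (s, t) ∈ Set.Iic x ×ˢ Set.Iic y ∧ curveNW (β * (1 - β)) β s ≤ t ∧ t ≤ 1} +
        (Set.Iic x ×ˢ Set.Iic y).indicator (fun p => ENNReal.ofReal (curveNW (β * (1 - β)) β p.1))
          (s, curveNW (β * (1 - β)) β s)) =
      {s | s ≤ x ∧ curveNW (β * (1 - β)) β s ≤ y}.indicator (fun _ => ENNReal.ofReal y) s := by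
    intro s hs
    have hc := curveNW_mem hβ hs.1 hs.2.le
    simp only [Set.mem_prod, Set.mem_Iic, Set.indicator_apply, Set.mem_ofPred_eq]
    by_cases h : s ≤ x ∧ curveNW (β * (1 - β)) β s ≤ y
    · have : {t | (s ≤ x ∧ t ≤ y) ∧ curveNW (β * (1 - β)) β s ≤ t ∧ t ≤ 1} =
          Set.Icc (curveNW (β * (1 - β)) β s) y := by
        ext t
        simp only [Set.mem_ofPred_eq, Set.mem_Icc]
        exact ⟨fun h => ⟨h.2.1, h.1.2⟩, fun h' => ⟨⟨h.1, h'.2⟩, h'.1, h'.2.trans hy.2⟩⟩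
      rw [this, Real.volume_Icc, if_pos h, if_pos h,
        ← ENNReal.ofReal_add (by linarith) (by linarith [hβ.2]), sub_add_cancel]
    · have : {t | (s ≤ x ∧ t ≤ y) ∧ curveNW (β * (1 - β)) β s ≤ t ∧ t ≤ 1} = ∅ := by
        rw [Set.eq_empty_iff_forall_notMem]
        rintro t ⟨⟨h1, h2⟩, h3, -⟩
        exact h ⟨h1, h3.trans h2⟩
      rw [this, measure_empty, if_neg h, if_neg h, add_zero]
  rw [setLIntegral_congr_fun measurableSet_Ioo hfib, lintegral_indicator_const hm2,
    Measure.restrict_apply hm2]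
  rcases hy.1.lt_or_eq with hy0 | rfl
  · have hiff : ∀ s, 1 - β ≤ y * (s + 1 - β) ↔ (1 - β) * (1 - y) / y ≤ s := by
      intro s
      rw [div_le_iff₀ hy0]
      constructor <;> intro h <;> linarith
    have h0 : 0 ≤ (1 - β) * (1 - y) / y :=
      div_nonneg (mul_nonneg (by linarith [hβ.2]) (by linarith [hy.2])) hy0.le
    rw [volume_eq_of_Ioo_subset_of_subset_Icc (a := (1 - β) * (1 - y) / y) (b := min x β),
      ← ENNReal.ofReal_mul hy0.le, mul_sub, mul_div_cancel₀ _ hy0.ne']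
    · rintro s ⟨hs1, hs2⟩
      rw [lt_min_iff] at hs2
      have hs3 := h0.trans_lt hs1
      exact ⟨⟨hs2.1.le, (curveNW_le_iff hβ hs3 hs2.2.le).2 ((hiff s).2 hs1.le)⟩, hs3, hs2.2⟩
    · rintro s ⟨⟨h1, h2⟩, h3, h4⟩
      exact ⟨(hiff s).1 ((curveNW_le_iff hβ h3 h4.le).1 h2), le_min h1 h4.le⟩
  · rw [ENNReal.ofReal_zero, zero_mul, eq_comm, ENNReal.ofReal_eq_zero]
    linarith [hβ.2]

/-- The distribution function of `ν` on the unit square. -/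
noncomputable def limitCdf (β x y : ℝ) : ℝ :=
  max (max (x - β) 0 * y) (min (x + (1 - β)) 1 * y - min (1 - β) (1 - x))

lemma limitCdf_nonneg {β x y : ℝ} (hy : 0 ≤ y) : 0 ≤ limitCdf β x y :=
  le_max_of_le_left (mul_nonneg (le_max_right _ _) hy)

lemma nu_Iic {β x y : ℝ} (hβ : β ∈ Set.Icc (0 : ℝ) 1) (hx : x ∈ Set.Icc (0 : ℝ) 1)
    (hy : y ∈ Set.Icc (0 : ℝ) 1) :
    nu (β * (1 - β)) β (Set.Iic x ×ˢ Set.Iic y) = ENNReal.ofReal (limitCdf β x y) := by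
  have hmax : ENNReal.ofReal (y * min x β - (1 - β) * (1 - y)) =
      ENNReal.ofReal (max (y * min x β - (1 - β) * (1 - y)) 0) := by
    rw [ENNReal.ofReal_max, ENNReal.ofReal_zero, max_eq_left (zero_le)]
  rw [nu_eq hβ, Measure.add_apply, nuSE_Iic hβ hx hy, nuNW_Iic hβ hy, hmax,
    ← ENNReal.ofReal_add (add_nonneg (mul_nonneg hy.1 (le_max_right _ _)) (le_max_right _ _))
      (le_max_right _ _)]
  congr 1
  rw [limitCdf]
  have hy' : 0 ≤ 1 - y := by linarith [hy.2]
  rcases le_total x β with h | h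
  · have h1 := mul_le_mul_of_nonneg_left h hy'
    rw [max_eq_right (show x - β ≤ 0 by linarith), min_eq_left h,
      min_eq_left (show x + (1 - β) ≤ 1 by linarith), min_eq_left (show 1 - β ≤ 1 - x by linarith),
      max_eq_right (show _ - max _ _ ≤ (0 : ℝ) by
        linarith [le_max_left ((1 - y) * β) ((1 - y) * (1 + β) - β)]), max_comm]
    rw [zero_mul, mul_zero, zero_add, zero_add]
    congr 1
    ring
  · have h1 := mul_le_mul_of_nonneg_left h hy'
    rw [max_eq_left (show 0 ≤ x - β by linarith), min_eq_right h,
      min_eq_right (show 1 ≤ x + (1 - β) by linarith),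
      min_eq_right (show 1 - x ≤ 1 - β by linarith)]
    -- For `y ≥ 1 - β` both sides are `x + y - 1`; for `y ≤ 1 - β` the left part contributes nothing
    -- and the right part is the maximum itself.
    rcases le_total 0 (y + β - 1) with h2 | h2
    · rw [max_eq_left (show (1 - y) * (1 + β) - β ≤ (1 - y) * β by linarith),
        max_eq_left (by linarith), max_eq_left (by linarith), max_eq_right (by linarith)]
      ring
    · rw [max_eq_right (show (1 - y) * β ≤ (1 - y) * (1 + β) - β by linarith),
        max_eq_right (show y * β - (1 - β) * (1 - y) ≤ 0 by linarith), add_zero, ← max_add_add_left,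
        max_comm, add_zero]
      congr 1 <;> ring

/-! ### `nu` is a permuton -/

lemma nu_compl_unitSquare {β : ℝ} (hβ : β ∈ Set.Icc (0 : ℝ) 1) :
    nu (β * (1 - β)) β unitSquareᶜ = 0 := by
  rw [nu_eq hβ, Measure.add_apply, nuSE_compl_unitSquare hβ, nuNW_compl_unitSquare hβ, add_zero]

lemma limitCdf_one_right {β x : ℝ} (hβ : β ∈ Set.Icc (0 : ℝ) 1) (hx : x ∈ Set.Icc (0 : ℝ) 1) :
    limitCdf β x 1 = x := by
  rw [limitCdf]
  rcases le_total x β with h | h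
  · rw [max_eq_right (show x - β ≤ 0 by linarith),
      min_eq_left (show x + (1 - β) ≤ 1 by linarith), min_eq_left (show 1 - β ≤ 1 - x by linarith),
      max_eq_right (by linarith [hx.1])]
    ring
  · rw [max_eq_left (show 0 ≤ x - β by linarith),
      min_eq_right (show 1 ≤ x + (1 - β) by linarith),
      min_eq_right (show 1 - x ≤ 1 - β by linarith), max_eq_right (by linarith [hβ.1])]
    ring

lemma limitCdf_one_left {β y : ℝ} (hβ : β ∈ Set.Icc (0 : ℝ) 1) (hy : y ∈ Set.Icc (0 : ℝ) 1) :
    limitCdf β 1 y = y := by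
  have := mul_nonneg hβ.1 hy.1
  rw [limitCdf, max_eq_left (show 0 ≤ 1 - β by linarith [hβ.2]),
    min_eq_right (show 1 ≤ 1 + (1 - β) by linarith [hβ.2]), sub_self,
    min_eq_right (show 0 ≤ 1 - β by linarith [hβ.2]), max_eq_right (by linarith)]
  ring

lemma measure_congr_of_unitSquare {μ : Measure (ℝ × ℝ)} (hμ : μ unitSquareᶜ = 0) {A B : Set (ℝ × ℝ)}
    (h : ∀ p ∈ unitSquare, p ∈ A ↔ p ∈ B) : μ A = μ B := by
  have hsq : ∀ᵐ p ∂μ, p ∈ unitSquare := hμ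
  apply measure_congr
  filter_upwards [hsq] with p hp
  exact propext (h p hp)

lemma isProbabilityMeasure_nu {β : ℝ} (hβ : β ∈ Set.Icc (0 : ℝ) 1) :
    IsProbabilityMeasure (nu (β * (1 - β)) β) := by
  constructor
  have h1 : (1 : ℝ) ∈ Set.Icc (0 : ℝ) 1 := by simp
  rw [measure_congr_of_unitSquare (nu_compl_unitSquare hβ) (A := Set.univ)
    (B := Set.Iic 1 ×ˢ Set.Iic 1)
    (fun p hp => ⟨fun _ => ⟨hp.1.2, hp.2.2⟩, fun _ => Set.mem_univ _⟩), nu_Iic hβ h1 h1,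
    limitCdf_one_left hβ h1, ENNReal.ofReal_one]

/-- A measure on the line with the distribution function of the uniform measure on `[0, 1]` gives
intervals their length. -/
lemma measure_Icc_of_cdf {μ : Measure ℝ} [IsFiniteMeasure μ] (h0 : μ (Set.Icc 0 1)ᶜ = 0)
    (h : ∀ a ∈ Set.Icc (0 : ℝ) 1, μ (Set.Iic a) = ENNReal.ofReal a) {a b : ℝ} (ha : 0 ≤ a)
    (hb : b ≤ 1) : μ (Set.Icc a b) = ENNReal.ofReal (b - a) := by
  have hμ : μ = volume.restrict (Set.Icc 0 1) := by
    refine Measure.ext_of_Iic _ _ (fun c => ?_)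
    rw [Measure.restrict_apply measurableSet_Iic]
    rcases lt_or_ge c 0 with hc | hc
    · have h1 : Set.Iic c ∩ Set.Icc 0 1 = ∅ := by
        rw [Set.eq_empty_iff_forall_notMem]
        exact fun s hs => absurd (hs.2.1.trans hs.1) hc.not_ge
      rw [h1, measure_empty]
      refine measure_mono_null (t := (Set.Icc 0 1)ᶜ) ?_ h0
      exact fun s hs h' => absurd (h'.1.trans hs) hc.not_ge
    · have hae : ∀ᵐ s ∂μ, s ∈ Set.Icc (0 : ℝ) 1 := h0
      have h1 : μ (Set.Iic c) = μ (Set.Iic (min c 1)) := by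
        apply measure_congr
        filter_upwards [hae] with s hs
        apply propext
        show s ≤ c ↔ s ≤ min c 1
        simp [hs.2]
      have h2 : Set.Iic c ∩ Set.Icc 0 1 = Set.Icc 0 (min c 1) := by
        ext s
        simp only [Set.mem_inter_iff, Set.mem_Iic, Set.mem_Icc, le_min_iff]
        tauto
      rw [h1, h _ ⟨le_min hc zero_le_one, min_le_right _ _⟩, h2, Real.volume_Icc, sub_zero]
  rw [hμ, Measure.restrict_apply measurableSet_Icc,
    Set.inter_eq_self_of_subset_left (Set.Icc_subset_Icc ha hb), Real.volume_Icc]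

lemma isPermuton_nu {β : ℝ} (hβ : β ∈ Set.Icc (0 : ℝ) 1) :
    IsPermuton (nu (β * (1 - β)) β) := by
  have hprob := isProbabilityMeasure_nu hβ
  have hsq := nu_compl_unitSquare hβ
  have h1 : (1 : ℝ) ∈ Set.Icc (0 : ℝ) 1 := by simp
  refine ⟨hprob, hsq, fun a b ha _ hb => ⟨?_, ?_⟩⟩
  · rw [← measure_Icc_of_cdf (μ := (nu (β * (1 - β)) β).map Prod.snd) ?_ ?_ ha hb,
      Measure.map_apply measurable_snd measurableSet_Icc]
    · exact measure_congr_of_unitSquare hsq (fun p hp => ⟨fun h => h.2, fun h => ⟨hp.1, h⟩⟩)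
    · rw [Measure.map_apply measurable_snd measurableSet_Icc.compl]
      refine measure_mono_null (t := unitSquareᶜ) ?_ hsq
      exact fun p hp h => hp h.2
    · intro c hc
      rw [Measure.map_apply measurable_snd measurableSet_Iic, ← limitCdf_one_left hβ hc,
        ← nu_Iic hβ h1 hc, limitCdf_one_left hβ hc]
      exact measure_congr_of_unitSquare hsq (fun p hp => ⟨fun h => ⟨hp.1.2, h⟩, fun h => h.2⟩)
  · rw [← measure_Icc_of_cdf (μ := (nu (β * (1 - β)) β).map Prod.fst) ?_ ?_ ha hb,
      Measure.map_apply measurable_fst measurableSet_Icc]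
    · exact measure_congr_of_unitSquare hsq (fun p hp => ⟨fun h => h.1, fun h => ⟨h, hp.2⟩⟩)
    · rw [Measure.map_apply measurable_fst measurableSet_Icc.compl]
      refine measure_mono_null (t := unitSquareᶜ) ?_ hsq
      exact fun p hp h => hp h.1
    · intro c hc
      rw [Measure.map_apply measurable_fst measurableSet_Iic, ← limitCdf_one_right hβ hc,
        ← nu_Iic hβ hc h1, limitCdf_one_right hβ hc]
      exact measure_congr_of_unitSquare hsq (fun p hp => ⟨fun h => ⟨h, hp.2.2⟩, fun h => h.1⟩)

/-! ### Passage to the limit -/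

lemma floor_add_ceil {β : ℝ} (hβ : β ∈ Set.Icc (0 : ℝ) 1) (n : ℕ) :
    ⌊(1 - β) * n⌋₊ + ⌈β * n⌉₊ = n := by
  have hn : (0 : ℝ) ≤ n := n.cast_nonneg
  have hc : ⌈β * n⌉₊ ≤ n := Nat.ceil_le.2 (mul_le_of_le_one_left hn hβ.2)
  have h1 := Nat.le_ceil (β * n)
  have h2 := Nat.ceil_lt_add_one (mul_nonneg hβ.1 hn)
  have : ⌊(1 - β) * n⌋₊ = n - ⌈β * n⌉₊ := by
    rw [Nat.floor_eq_iff (mul_nonneg (by linarith [hβ.2]) hn), Nat.cast_sub hc]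
    constructor <;> linarith
  omega

/-- The limit of the scaled counting functions after sorting an equidistributed sequence. -/
lemma tendsto_countBelow_tauWord {β : ℝ} (hβ : β ∈ Set.Icc (0 : ℝ) 1)
    {S : ℕ → Finset (ℤ × ℤ)} (hS : ∀ n : ℕ, IsRectangle (S n) ⌊(1 - β) * n⌋₊ ⌈β * n⌉₊)
    (hcontent : ∀ n : ℕ, ∀ b ∈ S n, 1 ≤ content b ∧ content b ≤ (n : ℤ) - 1)
    {w : ℕ → List ℤ} (hw : ∀ n : ℕ, IsWordOfShape (S n) (w n))
    {v : (n : ℕ) → Equiv.Perm (Fin n)} (hv : IsEquidistributed v) {x y : ℝ}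
    {p k : ℕ → ℕ} (hp : ∀ n, p n ≤ n) (hk : ∀ n, k n ≤ n)
    (hx : Tendsto (fun n => (p n : ℝ) / n) atTop (𝓝 x))
    (hy : Tendsto (fun n => (k n : ℝ) / n) atTop (𝓝 y)) :
    Tendsto (fun n => (countBelow (tauWord (w n) (v n)) (k n) (p n) : ℝ) / n) atTop
      (𝓝 (limitCdf β x y)) := by
  have hh : Tendsto (fun n : ℕ => (⌊(1 - β) * n⌋₊ : ℝ) / n) atTop (𝓝 (1 - β)) :=
    (tendsto_nat_floor_mul_div_atTop (by linarith [hβ.2])).comp tendsto_natCast_atTop_atTop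
  have hww : Tendsto (fun n : ℕ => (⌈β * n⌉₊ : ℝ) / n) atTop (𝓝 β) :=
    (tendsto_nat_ceil_mul_div_atTop hβ.1).comp tendsto_natCast_atTop_atTop
  have cast_tsub : ∀ a b : ℕ, ((a - b : ℕ) : ℝ) = max ((a : ℝ) - b) 0 := by
    intro a b
    rcases le_total b a with h | h
    · rw [Nat.cast_sub h, max_eq_left (sub_nonneg.2 (Nat.cast_le.2 h))]
    · rw [Nat.sub_eq_zero_of_le h, Nat.cast_zero, max_eq_right (sub_nonpos.2 (Nat.cast_le.2 h))]
  have hleft : Tendsto (fun n : ℕ => ((p n - ⌈β * n⌉₊ : ℕ) : ℝ) / n) atTop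
      (𝓝 (max (x - β) 0)) := by
    refine ((hx.sub hww).max tendsto_const_nhds).congr (fun n => ?_)
    rw [cast_tsub, ← max_div_div_right n.cast_nonneg, sub_div, zero_div]
  have hright : Tendsto (fun n : ℕ => ((min (p n + ⌊(1 - β) * n⌋₊) n : ℕ) : ℝ) / n) atTop
      (𝓝 (min (x + (1 - β)) 1)) := by
    refine ((hx.add hh).min tendsto_const_nhds).congr' ?_
    filter_upwards [eventually_gt_atTop 0] with n hn
    have hn' : (n : ℝ) ≠ 0 := by positivity
    rw [Nat.cast_min, ← min_div_div_right n.cast_nonneg, Nat.cast_add, add_div, div_self hn']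
  have hshift : Tendsto (fun n : ℕ => ((min ⌊(1 - β) * n⌋₊ (n - p n) : ℕ) : ℝ) / n) atTop
      (𝓝 (min (1 - β) (1 - x))) := by
    refine (hh.min (tendsto_const_nhds.sub hx)).congr' ?_
    filter_upwards [eventually_gt_atTop 0] with n hn
    have hn' : (n : ℝ) ≠ 0 := by positivity
    rw [Nat.cast_min, ← min_div_div_right n.cast_nonneg, Nat.cast_sub (hp n), sub_div,
      div_self hn']
  have t1 := hv.tendsto (fun n => (Nat.sub_le _ _).trans (hp n)) hk hleft hy
  have t2 := hv.tendsto (fun n => min_le_right _ _) hk hright hy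
  refine (t1.max (t2.sub hshift)).congr (fun n => ?_)
  -- The truncated subtraction adds a maximum with `0`, which the nonnegative first count absorbs.
  rw [countBelow_tauWord_rectangle (floor_add_ceil hβ n) (hS n) (hcontent n) (hw n) (v n) (hp n),
    Nat.cast_max, cast_tsub, max_comm (_ - _) (0 : ℝ), ← max_assoc,
    max_eq_left (Nat.cast_nonneg (α := ℝ) (countBelow (v n) (k n) ((p n - ⌈β * n⌉₊ : ℕ) : ℤ))),
    ← max_div_div_right n.cast_nonneg, sub_div]

lemma convergesWeakly_of_isEquidistributed {β : ℝ} (hβ : β ∈ Set.Icc (0 : ℝ) 1)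
    {S : ℕ → Finset (ℤ × ℤ)} (hS : ∀ n : ℕ, IsRectangle (S n) ⌊(1 - β) * n⌋₊ ⌈β * n⌉₊)
    (hcontent : ∀ n : ℕ, ∀ b ∈ S n, 1 ≤ content b ∧ content b ≤ (n : ℤ) - 1)
    {w : ℕ → List ℤ} (hw : ∀ n : ℕ, IsWordOfShape (S n) (w n))
    {v : (n : ℕ) → Equiv.Perm (Fin n)} (hv : IsEquidistributed v) :
    ConvergesWeakly (fun n => permPermuton (tauWord (w n) (v n))) (nu (β * (1 - β)) β) := by
  have hprob := isProbabilityMeasure_nu hβ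
  refine ⟨fun n => isFiniteMeasure_permPermuton _, inferInstance, ?_⟩
  -- The index is shifted because for `n = 0` the measure `permPermuton` is zero, not a probability
  -- measure.
  let μ : ℕ → ProbabilityMeasure (ℝ × ℝ) := fun n =>
    ⟨permPermuton (tauWord (w (n + 1)) (v (n + 1))),
      isProbabilityMeasure_permPermuton n.succ_pos _⟩
  let ν : ProbabilityMeasure (ℝ × ℝ) := ⟨nu (β * (1 - β)) β, hprob⟩
  suffices h : Tendsto μ atTop (𝓝 ν) from
    (tendsto_add_atTop_iff_nat (l := 𝓝 ν.toFiniteMeasure) 1).1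
      ((ProbabilityMeasure.tendsto_nhds_iff_toFiniteMeasure_tendsto_nhds _).1 h)
  refine tendsto_probabilityMeasure_of_tendsto_cdf_unitSquare
    (fun n => permPermuton_compl_unitSquare _) (nu_compl_unitSquare hβ) (fun x hx y hy => ?_)
  have hlim : (ν : Measure (ℝ × ℝ)).real (Set.Iic x ×ˢ Set.Iic y) = limitCdf β x y := by
    rw [measureReal_def]
    simp only [ν, ProbabilityMeasure.coe_mk]
    rw [nu_Iic hβ hx hy, ENNReal.toReal_ofReal (limitCdf_nonneg hy.1)]
  rw [hlim]
  exact (tendsto_add_atTop_iff_nat (f := fun n =>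
    (permPermuton (tauWord (w n) (v n))).real (Set.Iic x ×ˢ Set.Iic y)) 1).2
    (tendsto_permPermuton_real_Iic hx hy (fun p k hp hk hpx hky =>
      tendsto_countBelow_tauWord hβ hS hcontent hw hv hp hk hpx hky))

end BubblePermuton

theorem theorem1p5 (β : ℝ) (hβ : β ∈ Set.Icc (0 : ℝ) 1)
    (S : ℕ → Finset (ℤ × ℤ))
    (hS : ∀ n : ℕ, BubblePermuton.IsRectangle (S n) ⌊(1 - β) * n⌋₊ ⌈β * n⌉₊)
    (hcontent : ∀ n : ℕ, ∀ b ∈ S n,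
      1 ≤ BubblePermuton.content b ∧ BubblePermuton.content b ≤ (n : ℤ) - 1)
    (w : ℕ → List ℤ) (hw : ∀ n : ℕ, BubblePermuton.IsWordOfShape (S n) (w n))
    {Ω : Type*} [MeasurableSpace Ω] (P : Measure Ω) [IsProbabilityMeasure P]
    (v : (n : ℕ) → Ω → Equiv.Perm (Fin n))
    (hv : ∀ n : ℕ, BubblePermuton.IsUniformPerm P (v n)) :
    BubblePermuton.IsPermuton (BubblePermuton.nu (β * (1 - β)) β) ∧
    ∀ᵐ ω ∂P, BubblePermuton.ConvergesWeakly
      (fun n => BubblePermuton.permPermuton (BubblePermuton.tauWord (w n) (v n ω)))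
      (BubblePermuton.nu (β * (1 - β)) β) := by
  refine ⟨BubblePermuton.isPermuton_nu hβ, ?_⟩
  filter_upwards [BubblePermuton.ae_isEquidistributed hv] with ω hω
  exact BubblePermuton.convergesWeakly_of_isEquidistributed hβ hS hcontent hw hω
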